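/- Let $I=\mathbb Z_+$ or $I=\mathbb R_+$. Let $(X_t)_{t\in I}$ be a time-homogeneous Markov process with values in a measurable space $(E,\mathcal E)$, with laws $(\mathbb P_x)_{x\in E}$, $\mathbb P_x(X_0=x)=1$, and $\mathbb P_\mu=\int\mathbb P_x\,\mu(dx)$; the process is adapted to a filtration with respect to which it is Markov (for instance the natural one), on a space carrying shift operators. Let $A_t\in\mathcal E$ ($t\in I$), $E_t=E\setminus A_t$, and for $s\in I$ let $\tau_{A\circ\theta_s}=\inf\{t\in I: X_t\in A_{s+t}\}$ and $\tau_A=\tau_{A\circ\theta_0}$. Assume that each $\tau_{A\circ\theta_s}$ is a stopping time and that, for all $s,t\in I$ and $x\in E_s$, $\mathbb P_x(\tau_{A\circ\theta_s}<\infty)=1$ and $\mathbb P_x(\tau_{A\circ\theta_s}>t)>0$. Assume moreover that there are probability measures $\nu_s$ on $E_s$ ($s\in I$), a time $t_0\in I$ with $t_0>0$, and constants $c_1,c_2>0$ such that, for all $s,t\in I$ and $x\in E_s$, $$\mathbb P_x(X_{t_0}\in\cdot\mid\tau_{A\circ\theta_s}>t_0)\ \ge\ c_1\,\nu_{s+t_0},\qquad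 \mathbb P_{\nu_s}(\tau_{A\circ\theta_s}>t)\ \ge\ c_2\,\mathbb P_x(\tau_{A\circ\theta_s}>t).$$ Then there exist measurable functions $\eta_s:E\to\mathbb R$ ($s\in I$), positive and bounded on $E_s$, with $$\lim_{t\to\infty}\frac{\mathbb P_x(\tau_{A\circ\theta_s}>t)}{\mathbb P_y(\tau_{A\circ\theta_s}>t)}=\frac{\eta_s(x)}{\eta_s(y)}\qquad(x,y\in E_s),$$ and a $Q$-process, that is, a family of probability measures $(\mathbb Q_{s,x})_{s\in I,\,x\in E_s}$ on trajectories such that for all $s,t\in I$ and $x\in E_s$ the conditional laws $\mathbb P_x(X_{[0,t]}\in\cdot\mid\tau_{A\circ\theta_s}>t+T)$ converge, as $T\to\infty$, to $\mathbb Q_{s,x}(X_{[s,s+t]}\in\cdot)$, tested against every bounded measurable functional of the trajectory (in particular weakly). It is given by $$\mathbb Q_{s,x}(X_{[s,s+t]}\in\cdot)=\frac{\mathbb E_x\big(\mathbf 1_{X_{[0,t]}\in\cdot}\,\mathbf 1_{\tau_{A\circ\theta_s}>t}\,\eta_{s+t}(X_t)\big)}{\mathbb E_x\big(\mathbf 1_{\tau_{A\circ\theta_s}>t}\,\eta_{s+t}(X_t)\big)},$$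 and the following hold. 1. For all $s,t,T\in I$ and $x\in E_s$, $$\big\|\mathbb P_x(X_{[0,t]}\in\cdot\mid\tau_{A\circ\theta_s}>t+T)-\mathbb Q_{s,x}(X_{[s,s+t]}\in\cdot)\big\|_{TV}\le\frac{1}{(c_1c_2)^3\,\mathbb P_x(\tau_{A\circ\theta_s}>t_0)}\;\frac{\mathbb P_x(\tau_{A\circ\theta_s}>t)}{\sup_{y\in E_{s+t_0}}\mathbb P_y(\tau_{A\circ\theta_{s+t_0}}>t)}\;(1-c_1c_2)^{\lfloor T/t_0\rfloor},$$ where $\|\mu_1-\mu_2\|_{TV}=\sup_B|\mu_1(B)-\mu_2(B)|$ over the measurable sets $B$ of trajectories $E^{[0,t]}$ with the product $\sigma$-algebra. 2. Suppose in addition that for every $x\in E_0$ $$\sup_{t\in I}\frac{\mathbb P_x(\tau_A>t)}{\sup_{y\in E_{t_0}}\mathbb P_y(\tau_{A\circ\theta_{t_0}}>t)}<\infty ,$$ that $E$ is equipped with a topology whose open sets are measurable, that $(t,\omega)\mapsto X_t(\omega)$ is jointly measurable if $I=\mathbb R_+$, and that there is a probability measure $\beta$ on $E$ such that, for every $x\in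 E_0$, weakly as $t\to\infty$, $$\frac1t\int_0^t\mathbb Q_{0,x}(X_u\in\cdot)\,du\longrightarrow\beta .$$ Then for every $x\in E_0$, weakly as $t\to\infty$, $$\frac1t\int_0^t\mathbb P_x(X_u\in\cdot\mid\tau_A>t)\,du\longrightarrow\beta ,$$ i.e. $\beta$ is the quasi-ergodic distribution starting from any $x\in E_0$. For $I=\mathbb Z_+$ the means $\frac1t\int_0^t\cdots du$ are read as $\frac1n\sum_{k=0}^n\cdots$, with $t=n$. -/

import Mathlib

open MeasureTheory ProbabilityTheory Filter Topology
open scoped NNReal ENNReal BoundedContinuousFunction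

/-- A time-homogeneous Markov process with time set `I` and values in the measurable space `E`:
random variables `X t` on a measurable space `Ω`, adapted to a filtration `F` (for instance the
natural one), shift operators with `X t ∘ shift r = X (r + t)`, and a measurable family `P x` of
probability measures with `P x (X 0 = x) = 1`, such that the Markov property
`P x (shift r ⁻¹ B | F r) = P (X r) B` holds for every event `B` of `σ (F t, t ∈ I)`. -/
structure MarkovFamily (I : Type) [AddMonoid I] [Preorder I]
    (E : Type*) [MeasurableSpace E] (Ω : Type*) [mΩ : MeasurableSpace Ω] where
  X : I → Ω → E
  F : Filtration I mΩ
  shift : I → Ω → Ω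
  P : Kernel E Ω
  isMarkovKernel_P : IsMarkovKernel P
  measurable_X : ∀ t, Measurable[F t] (X t)
  P_start : ∀ x, P x {ω | X 0 ω = x} = 1
  X_shift : ∀ r t ω, X t (shift r ω) = X (r + t) ω
  measurable_shift : ∀ r t, Measurable[F (r + t), F t] (shift r)
  markov : ∀ (r : I) (x : E) (C B : Set Ω), MeasurableSet[F r] C → MeasurableSet[⨆ t, F t] B →
    P x (C ∩ shift r ⁻¹' B) = ∫⁻ ω in C, P (X r ω) B ∂(P x)

/-- The total variation distance `sup_B |μ₁ B - μ₂ B|`, over all measurable sets `B`. -/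
noncomputable def tvDist {S : Type*} [MeasurableSpace S] (μ₁ μ₂ : Measure S) : ℝ :=
  ⨆ B : {B : Set S // MeasurableSet B}, |μ₁.real B - μ₂.real B|

namespace MarkovFamily

variable {I : Type} [AddMonoid I] [ConditionallyCompleteLinearOrderBot I]
  {E : Type*} [MeasurableSpace E] {Ω : Type*} [MeasurableSpace Ω]

/-- `τ_{A ∘ θ_s} = inf {t : X_t ∈ A_{s+t}}`, equal to `⊤` if there is no such `t`. -/
noncomputable def hit (M : MarkovFamily I E Ω) (A : I → Set E) (s : I) (ω : Ω) : WithTop I :=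
  sInf ((fun t : I => (t : WithTop I)) '' {t | M.X t ω ∈ A (s + t)})

/-- The event `τ_{A ∘ θ_s} > t`. -/
def surv (M : MarkovFamily I E Ω) (A : I → Set E) (s t : I) : Set Ω :=
  {ω | (t : WithTop I) < M.hit A s ω}

/-- `A` is a moving absorbing boundary: measurable sets whose hitting times are stopping times,
almost surely finite, and exceed any given time with positive probability when the process starts
in the survival set `E_s`, the complement of `A s`. -/
structure IsMovingBoundary (M : MarkovFamily I E Ω) (A : I → Set E) : Prop where
  measurableSet : ∀ t, MeasurableSet (A t)
  isStoppingTime : ∀ s, IsStoppingTime M.F (M.hit A s)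
  finite : ∀ s, ∀ x ∈ (A s)ᶜ, ∀ᵐ ω ∂(M.P x), M.hit A s ω < ⊤
  survive : ∀ s t, ∀ x ∈ (A s)ᶜ, 0 < M.P x (M.surv A s t)

/-- The Champagnat-Villemonais type condition for a moving boundary, with probability measures
`ν s` on `E_s` and constants `t₀, c₁, c₂ > 0`. -/
structure ChampagnatVillemonais (M : MarkovFamily I E Ω) (A : I → Set E)
    (ν : I → Measure E) (t₀ : I) (c₁ c₂ : ℝ) : Prop where
  isProbabilityMeasure : ∀ s, IsProbabilityMeasure (ν s)
  null : ∀ s, ν s (A s) = 0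
  t₀_pos : 0 < t₀
  c₁_pos : 0 < c₁
  c₂_pos : 0 < c₂
  minorization : ∀ s, ∀ x ∈ (A s)ᶜ,
    ENNReal.ofReal c₁ • ν (s + t₀) ≤ ((M.P x)[|M.surv A s t₀]).map (M.X t₀)
  comparison : ∀ s t, ∀ x ∈ (A s)ᶜ,
    c₂ * (M.P x).real (M.surv A s t) ≤ ((ν s).bind M.P).real (M.surv A s t)

/-- The trajectory `X_{[0,t]}`. -/
def path (M : MarkovFamily I E Ω) (t : I) (ω : Ω) : Set.Icc (0 : I) t → E :=
  fun u => M.X u ω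

/-- The law `P_x (X_{[0,t]} ∈ · | τ_{A ∘ θ_s} > r)` on the product space `E^[0,t]`. -/
noncomputable def condPathLaw (M : MarkovFamily I E Ω) (A : I → Set E) (s : I) (x : E) (t r : I) :
    Measure (Set.Icc (0 : I) t → E) :=
  ((M.P x)[|M.surv A s r]).map (M.path t)

end MarkovFamily

/-- For a law `q` on trajectories `w : I → E`, the law of `w_{[s,s+t]}`, written on `E^[0,t]`
through `u ↦ w (s + u)`. -/
noncomputable def segmentLaw {I : Type} [AddMonoid I] [Preorder I] {E : Type*} [MeasurableSpace E]
    (q : Measure (I → E)) (s t : I) : Measure (Set.Icc (0 : I) t → E) :=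
  q.map (fun w u => w (s + u))

namespace MarkovFamily

variable {I : Type} [AddMonoid I] [ConditionallyCompleteLinearOrderBot I]
  {E : Type*} [MeasurableSpace E] {Ω : Type*} [MeasurableSpace Ω]

/-- `Q` is the `Q`-process: `Q s x`, for `x ∈ E_s`, is a probability measure on trajectories, and
`P_x (X_{[0,t]} ∈ · | τ_{A ∘ θ_s} > t + T)` converges to `Q_{s,x} (X_{[s,s+t]} ∈ ·)` as `T → ∞`.
Convergence is tested against all bounded measurable functionals of the trajectory, hence in
particular against the bounded continuous ones for any topology on trajectories. -/
def IsQProcessFamily (M : MarkovFamily I E Ω) (A : I → Set E) (Q : I → E → Measure (I → E)) : Prop :=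
  ∀ s, ∀ x ∈ (A s)ᶜ, IsProbabilityMeasure (Q s x) ∧
    ∀ (t : I) (f : (Set.Icc (0 : I) t → E) → ℝ), Measurable f → (∃ K, ∀ p, |f p| ≤ K) →
      Tendsto (fun T : I => ∫ p, f p ∂(M.condPathLaw A s x t (t + T))) atTop
        (𝓝 (∫ p, f p ∂(segmentLaw (Q s x) s t)))

/-- The functions `η s` are measurable, bounded and positive on `E_s`, with
`P_x (τ_{A ∘ θ_s} > t) / P_y (τ_{A ∘ θ_s} > t) → η s x / η s y` as `t → ∞`. -/
structure IsSurvivalProfile (M : MarkovFamily I E Ω) (A : I → Set E) (η : I → E → ℝ) : Prop where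
  measurable : ∀ s, Measurable (η s)
  pos : ∀ s, ∀ x ∈ (A s)ᶜ, 0 < η s x
  bounded : ∀ s, ∃ K, ∀ x ∈ (A s)ᶜ, η s x ≤ K
  tendsto_ratio : ∀ s, ∀ x ∈ (A s)ᶜ, ∀ y ∈ (A s)ᶜ,
    Tendsto (fun t : I => (M.P x).real (M.surv A s t) / (M.P y).real (M.surv A s t)) atTop
      (𝓝 (η s x / η s y))

/-- `Q_{s,x}(X_{[s,s+t]} ∈ B)` equals
`E_x (1_{X_{[0,t]} ∈ B} 1_{τ_{A∘θ_s} > t} η_{s+t}(X_t)) / E_x (1_{τ_{A∘θ_s} > t} η_{s+t}(X_t))`. -/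
def IsProfileTransform (M : MarkovFamily I E Ω) (A : I → Set E) (η : I → E → ℝ)
    (Q : I → E → Measure (I → E)) : Prop :=
  ∀ s t, ∀ x ∈ (A s)ᶜ, ∀ B : Set (Set.Icc (0 : I) t → E), MeasurableSet B →
    (segmentLaw (Q s x) s t).real B =
      (∫ ω in M.path t ⁻¹' B ∩ M.surv A s t, η (s + t) (M.X t ω) ∂(M.P x)) /
        ∫ ω in M.surv A s t, η (s + t) (M.X t ω) ∂(M.P x)

/-- `sup_{y ∈ E_s} P_y (τ_{A ∘ θ_s} > t)`. -/
noncomputable def supSurv (M : MarkovFamily I E Ω) (A : I → Set E) (s t : I) : ℝ :=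
  ⨆ y : ((A s)ᶜ : Set E), (M.P y).real (M.surv A s t)

/-- For every `x ∈ E_0`,
`sup_t P_x (τ_A > t) / sup_{y ∈ E_{t₀}} P_y (τ_{A ∘ θ_{t₀}} > t) < ∞`. -/
def RatioCondition (M : MarkovFamily I E Ω) (A : I → Set E) (t₀ : I) : Prop :=
  ∀ x ∈ (A 0)ᶜ,
    BddAbove (Set.range fun t : I => (M.P x).real (M.surv A 0 t) / M.supSurv A t₀ t)

end MarkovFamily

/-! Write `f_{s,T}(x)` for the probability of surviving up to `T` from `x` (`survProb`), and `c = c₁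
* c₂`. The whole proof rests on the Markov identity `f_{s,t+r}(x) = E_x(1_{τ>t} f_{s+t,r}(X_t))` and
on a Doeblin argument for the process conditioned to survive. Minorization bounds the law of
`X_{t₀}` below by `ν`, and comparison says that `ν`-averages of survival probabilities are
comparable to their suprema; hence, given survival up to `t₀ + T`, every starting point shares a
component of mass at least `c` (`le_survProb_step`).

Consequently the oscillation in `x` of the ratio `f_{s,T+r}/f_{s,T}` shrinks by `1 - c` in each step
of length `t₀` (`exists_survProb_bounds`). This ratio is also at least `c` times the relevant
supremum (`le_survProb_add_of_le`), so the relative error after `n` steps is `(1 - c)^n / c`. Two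
consequences follow: `f_{s,T}/ν_s(f_{s,T})` is Cauchy in `T`, with limit `η_s`, and the conditional
path laws given survival up to `t + T` converge at that rate, uniformly in `s`, `t`, `x`. This
uniform bound is sharper than the stated one.

The `Q`-process is the `η`-transform. Since `E_x(1_{τ>t} η_{s+t}(X_t)) = l η_s(x)` with `l` free of
`x`, the transformed laws are consistent and Markov. As `E` is only a measurable space, they are
extended to all times by the Ionescu-Tulcea theorem, applied to the chain of path segments of length
`t₀` (`exists_segmentLaw_eq`). The quasi-ergodic statement follows because the error at time `u`
under survival up to `t` depends only on `t - u`, and so vanishes in time average. -/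

namespace MarkovFamily

attribute [instance] MarkovFamily.isMarkovKernel_P

/-! ### Hitting times, initial laws and survival probabilities -/

section Basic

variable {I : Type} [AddMonoid I] [ConditionallyCompleteLinearOrderBot I]
  {E : Type*} [MeasurableSpace E] {Ω : Type*} [MeasurableSpace Ω]
  {M : MarkovFamily I E Ω} {A : I → Set E}

/-- The infimum need not be attained, so `τ > t` requires a gap: a time `c > t` below all hits. When
there is no hit, a finite `c` exists because `I` has no maximum. -/
theorem mem_surv_iff [NoMaxOrder I] {s t : I} {ω : Ω} :
    ω ∈ M.surv A s t ↔ ∃ c, t < c ∧ ∀ u, M.X u ω ∈ A (s + u) → c ≤ u := by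
  change (t : WithTop I) < sInf _ ↔ _
  rw [lt_isGLB_iff (WithTop.isGLB_sInf _)]
  constructor
  · rintro ⟨c, hc, htc⟩
    induction c with
    | top =>
      obtain ⟨d, hd⟩ := exists_gt t
      exact ⟨d, hd, fun u hu => absurd (hc ⟨u, hu, rfl⟩) (by simp)⟩
    | coe c =>
      exact ⟨c, WithTop.coe_lt_coe.1 htc, fun u hu => WithTop.coe_le_coe.1 (hc ⟨u, hu, rfl⟩)⟩
  · rintro ⟨c, htc, hc⟩
    refine ⟨c, ?_, WithTop.coe_lt_coe.2 htc⟩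
    rintro _ ⟨u, hu, rfl⟩
    exact WithTop.coe_le_coe.2 (hc u hu)

theorem IsMovingBoundary.measurableSet_surv_filtration (hA : M.IsMovingBoundary A) (s t : I) :
    MeasurableSet[M.F t] (M.surv A s t) := by
  have h : M.surv A s t = {ω | M.hit A s ω ≤ t}ᶜ := by
    ext ω; simp [surv]
  rw [h]
  exact (hA.isStoppingTime s t).compl

theorem IsMovingBoundary.measurableSet_surv (hA : M.IsMovingBoundary A) (s t : I) :
    MeasurableSet (M.surv A s t) :=
  M.F.le t _ (hA.measurableSet_surv_filtration s t)

theorem measurable_coord (M : MarkovFamily I E Ω) (t : I) : Measurable (M.X t) :=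
  (M.measurable_X t).mono (M.F.le t) le_rfl

theorem measurable_path_filtration (M : MarkovFamily I E Ω) (t : I) :
    Measurable[M.F t] (M.path t) := by
  refine @measurable_pi_lambda _ _ _ (M.F t) _ _ fun u => ?_
  exact (M.measurable_X u).mono (M.F.mono u.2.2) le_rfl

theorem measurable_path (M : MarkovFamily I E Ω) (t : I) : Measurable (M.path t) :=
  (M.measurable_path_filtration t).mono (M.F.le t) le_rfl

/-- Singletons of `E` need not be measurable; `P_start` is therefore transferred to measurable `B ∋
x` by monotonicity of the outer measure. -/
theorem map_start (M : MarkovFamily I E Ω) (x : E) :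
    (M.P x).map (M.X 0) = Measure.dirac x := by
  have key : ∀ B : Set E, MeasurableSet B → x ∈ B → (M.P x).map (M.X 0) B = 1 := by
    intro B hB hx
    rw [Measure.map_apply (M.measurable_coord 0) hB]
    refine le_antisymm prob_le_one ?_
    rw [← M.P_start x]
    refine measure_mono fun ω (hω : M.X 0 ω = x) => ?_
    simpa [hω] using hx
  have : IsProbabilityMeasure ((M.P x).map (M.X 0)) :=
    Measure.isProbabilityMeasure_map (M.measurable_coord 0).aemeasurable
  ext B hB
  rw [Measure.dirac_apply' _ hB]
  by_cases hx : x ∈ B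
  · simp [hx, key B hB hx]
  · have := key Bᶜ hB.compl hx
    simp [hx, (prob_compl_eq_one_iff hB).1 this]

theorem ae_start_mem (M : MarkovFamily I E Ω) {x : E} {B : Set E} (hB : MeasurableSet B)
    (hx : x ∈ B) : ∀ᵐ ω ∂(M.P x), M.X 0 ω ∈ B := by
  have h : ∀ᵐ y ∂((M.P x).map (M.X 0)), y ∈ B := by
    rw [M.map_start]
    refine (ae_dirac_iff hB).2 ?_
    exact hx
  exact (ae_map_iff (M.measurable_coord 0).aemeasurable hB).1 h

/-- `P_x (τ_{A ∘ θ_s} > t)`. -/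
noncomputable def survProb (M : MarkovFamily I E Ω) (A : I → Set E) (s t : I) (x : E) : ℝ :=
  (M.P x).real (M.surv A s t)


theorem IsMovingBoundary.measurable_survProb (hA : M.IsMovingBoundary A) (s t : I) :
    Measurable (M.survProb A s t) :=
  (M.P.measurable_coe (hA.measurableSet_surv s t)).ennreal_toReal

theorem survProb_nonneg (s t : I) (x : E) : 0 ≤ M.survProb A s t x := measureReal_nonneg

theorem survProb_le_one (s t : I) (x : E) : M.survProb A s t x ≤ 1 := measureReal_le_one

theorem abs_survProb_le_one (s t : I) (x : E) : |M.survProb A s t x| ≤ 1 := by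
  rw [abs_of_nonneg (survProb_nonneg s t x)]
  exact survProb_le_one s t x

theorem IsMovingBoundary.survProb_pos (hA : M.IsMovingBoundary A) (s t : I) {x : E}
    (hx : x ∈ (A s)ᶜ) : 0 < M.survProb A s t x :=
  ENNReal.toReal_pos (hA.survive s t x hx).ne' (measure_ne_top _ _)

theorem ofReal_survProb (s t : I) (x : E) :
    ENNReal.ofReal (M.survProb A s t x) = M.P x (M.surv A s t) := by
  simp [survProb, measureReal_def]

theorem bddAbove_survProb (s t : I) :
    BddAbove (Set.range fun y : ((A s)ᶜ : Set E) => M.survProb A s t y) :=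
  ⟨1, by rintro _ ⟨y, rfl⟩; exact survProb_le_one _ _ _⟩

theorem survProb_le_supSurv_of_mem (s t : I) {x : E} (hx : x ∈ (A s)ᶜ) :
    M.survProb A s t x ≤ M.supSurv A s t :=
  le_ciSup (bddAbove_survProb s t) ⟨x, hx⟩

theorem supSurv_nonneg (s t : I) : 0 ≤ M.supSurv A s t :=
  Real.iSup_nonneg fun y => survProb_nonneg s t y.1

theorem integrable_of_abs_le {α : Type*} {mα : MeasurableSpace α} {μ : Measure α}
    [IsFiniteMeasure μ] {f : α → ℝ} (hf : Measurable f) {K : ℝ} (hK : ∀ a, |f a| ≤ K) :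
    Integrable f μ :=
  Integrable.of_bound hf.aestronglyMeasurable K (ae_of_all _ hK)

theorem IsMovingBoundary.integrable_survProb (hA : M.IsMovingBoundary A) (s t : I)
    (μ : Measure E) [IsFiniteMeasure μ] : Integrable (M.survProb A s t) μ :=
  integrable_of_abs_le (hA.measurable_survProb s t) (abs_survProb_le_one s t)

theorem survProb_antitone (s : I) (x : E) {t t' : I} (h : t ≤ t') :
    M.survProb A s t' x ≤ M.survProb A s t x :=
  measureReal_mono fun ω (hω : (t' : WithTop I) < _) =>
    lt_of_le_of_lt (WithTop.coe_le_coe.2 h) hω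

end Basic

/-! ### The Markov property for survival probabilities -/

section MarkovProperty

set_option linter.unusedSectionVars false

variable {I : Type} [AddCommMonoid I] [ConditionallyCompleteLinearOrderBot I]
  [IsOrderedCancelAddMonoid I] [CanonicallyOrderedAdd I] [Sub I] [OrderedSub I] [NoMaxOrder I]
  {E : Type*} [MeasurableSpace E] {Ω : Type*} [MeasurableSpace Ω]
  {M : MarkovFamily I E Ω} {A : I → Set E}

theorem surv_add (s t r : I) :
    M.surv A s (t + r) = M.surv A s t ∩ M.shift t ⁻¹' M.surv A (s + t) r := by
  ext ω
  simp only [Set.mem_inter_iff, Set.mem_preimage, mem_surv_iff, M.X_shift, add_assoc]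
  constructor
  · rintro ⟨c, hc, h⟩
    refine ⟨⟨c, lt_of_le_of_lt le_self_add hc, h⟩, c - t, lt_tsub_iff_left.2 hc, fun u hu => ?_⟩
    exact tsub_le_iff_left.2 (h _ hu)
  · rintro ⟨⟨c, hc, h⟩, d, hd, h'⟩
    refine ⟨t + d, add_lt_add_right hd t, fun u hu => ?_⟩
    -- Survival up to `t` forces every hit to occur after `t`, hence to be seen by the shifted
    -- trajectory.
    obtain ⟨v, rfl⟩ := exists_add_of_le (hc.le.trans (h u hu))
    exact add_le_add_right (h' v hu) t

/-- Thanks to this vanishing, the later inequalities hold for all `x : E` and can be integrated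
without tracking whether `X_t` lies in `E_{s+t}`. -/
theorem survProb_of_mem (hA : M.IsMovingBoundary A) (s t : I) {x : E}
    (hx : x ∈ A s) : M.survProb A s t x = 0 := by
  have h : ∀ᵐ ω ∂(M.P x), ω ∉ M.surv A s t := by
    filter_upwards [M.ae_start_mem (hA.measurableSet s) hx] with ω hω hs
    obtain ⟨c, hc, h⟩ := mem_surv_iff.1 hs
    exact absurd (hc.trans_le (h 0 (by simpa using hω))) not_lt_zero
  rw [survProb, measureReal_def, measure_eq_zero_iff_ae_notMem.2 h, ENNReal.toReal_zero]

theorem survProb_le_supSurv (hA : M.IsMovingBoundary A) (s t : I) (x : E) :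
    M.survProb A s t x ≤ M.supSurv A s t := by
  by_cases hx : x ∈ A s
  · rw [survProb_of_mem hA s t hx]
    exact supSurv_nonneg s t
  · exact survProb_le_supSurv_of_mem s t hx

theorem measure_inter_surv_add (hA : M.IsMovingBoundary A) (s t r : I) (x : E) {C : Set Ω}
    (hC : MeasurableSet[M.F t] C) :
    M.P x (C ∩ M.surv A s (t + r)) =
      ∫⁻ ω in C ∩ M.surv A s t, ENNReal.ofReal (M.survProb A (s + t) r (M.X t ω)) ∂(M.P x) := by
  rw [surv_add, ← Set.inter_assoc, M.markov t x _ _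
    (hC.inter (hA.measurableSet_surv_filtration s t))
    (le_iSup (fun t => (M.F t : MeasurableSpace Ω)) r _
      (hA.measurableSet_surv_filtration (s + t) r))]
  simp only [ofReal_survProb]

/-- The Markov property replaces the future by a density only when tested on events of `F t`, so the
two measures are compared after mapping to paths on `[0,t]`. -/
theorem restrict_surv_add_map_path (hA : M.IsMovingBoundary A) (s t r : I) (x : E) :
    ((M.P x).restrict (M.surv A s (t + r))).map (M.path t) =
      (((M.P x).restrict (M.surv A s t)).withDensity
        fun ω => ENNReal.ofReal (M.survProb A (s + t) r (M.X t ω))).map (M.path t) := by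
  ext B hB
  have hB' := M.measurable_path t hB
  rw [Measure.map_apply (M.measurable_path t) hB, Measure.map_apply (M.measurable_path t) hB,
    Measure.restrict_apply hB', withDensity_apply _ hB', Measure.restrict_restrict hB']
  exact measure_inter_surv_add hA s t r x (M.measurable_path_filtration t hB)

/-- Conditioning at time `t`: a path functional on the event of survival up to `t + r`. -/
theorem setIntegral_surv_add (hA : M.IsMovingBoundary A) (s t r : I) (x : E)
    {g : (Set.Icc (0 : I) t → E) → ℝ} (hg : Measurable g) :
    ∫ ω in M.surv A s (t + r), g (M.path t ω) ∂(M.P x) =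
      ∫ ω in M.surv A s t, g (M.path t ω) * M.survProb A (s + t) r (M.X t ω) ∂(M.P x) := by
  have hm : Measurable fun ω => ENNReal.ofReal (M.survProb A (s + t) r (M.X t ω)) :=
    ((hA.measurable_survProb (s + t) r).comp (M.measurable_coord t)).ennreal_ofReal
  rw [← integral_map (M.measurable_path t).aemeasurable hg.aestronglyMeasurable,
    restrict_surv_add_map_path hA,
    integral_map (M.measurable_path t).aemeasurable hg.aestronglyMeasurable,
    integral_withDensity_eq_integral_toReal_smul hm (by simp)]
  simp only [ENNReal.toReal_ofReal (survProb_nonneg _ _ _), smul_eq_mul, mul_comm]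

theorem survProb_add (hA : M.IsMovingBoundary A) (s t r : I) (x : E) :
    M.survProb A s (t + r) x =
      ∫ ω in M.surv A s t, M.survProb A (s + t) r (M.X t ω) ∂(M.P x) := by
  have h := setIntegral_surv_add hA s t r x (g := fun _ => 1) measurable_const
  simpa [survProb] using h

theorem survProb_add_le (hA : M.IsMovingBoundary A) (s t r : I) (x : E) :
    M.survProb A s (t + r) x ≤ M.survProb A s t x * M.supSurv A (s + t) r := by
  rw [survProb_add hA]
  refine (integral_mono (integrable_of_abs_le
    ((hA.measurable_survProb _ _).comp (M.measurable_coord t))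
    fun _ => abs_survProb_le_one _ _ _) (integrable_const _)
    fun ω => survProb_le_supSurv hA (s + t) r (M.X t ω)).trans ?_
  simp [survProb]

end MarkovProperty

end MarkovFamily

/-! ### Doeblin contraction for the conditioned process -/

namespace MarkovFamily

section Basic

variable {I : Type} [AddMonoid I] [ConditionallyCompleteLinearOrderBot I]
  {E : Type*} [MeasurableSpace E] {Ω : Type*} [MeasurableSpace Ω]
  {M : MarkovFamily I E Ω} {A : I → Set E} {ν : I → Measure E} {t₀ : I} {c₁ c₂ : ℝ}

theorem ChampagnatVillemonais.nonempty (hC : M.ChampagnatVillemonais A ν t₀ c₁ c₂) (s : I) :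
    Nonempty ((A s)ᶜ : Set E) := by
  by_contra h
  have := hC.isProbabilityMeasure s
  have h1 : A s = Set.univ := by
    rw [← compl_compl (A s), Set.not_nonempty_iff_eq_empty.1 (mt Set.nonempty_coe_sort.2 h),
      Set.compl_empty]
  have h2 := hC.null s
  simp [h1] at h2

theorem ChampagnatVillemonais.mul_pos (hC : M.ChampagnatVillemonais A ν t₀ c₁ c₂) :
    0 < c₁ * c₂ :=
  _root_.mul_pos hC.c₁_pos hC.c₂_pos

end Basic

section Contraction

variable {I : Type} [AddCommMonoid I] [ConditionallyCompleteLinearOrderBot I]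
  [IsOrderedCancelAddMonoid I] [CanonicallyOrderedAdd I] [Sub I] [OrderedSub I] [NoMaxOrder I]
  {E : Type*} [MeasurableSpace E] {Ω : Type*} [MeasurableSpace Ω]
  {M : MarkovFamily I E Ω} {A : I → Set E} {ν : I → Measure E} {t₀ : I} {c₁ c₂ : ℝ}

/-- Multiplying the conditional minorization by the survival probability removes the division and
makes it valid on `A s` too. -/
theorem ChampagnatVillemonais.minorization_integral (hA : M.IsMovingBoundary A)
    (hC : M.ChampagnatVillemonais A ν t₀ c₁ c₂) (s : I) (x : E) {φ : E → ℝ}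
    (hφ : Measurable φ) (h0 : ∀ y, 0 ≤ φ y) {K : ℝ} (hK : ∀ y, |φ y| ≤ K) :
    c₁ * M.survProb A s t₀ x * ∫ y, φ y ∂(ν (s + t₀)) ≤
      ∫ ω in M.surv A s t₀, φ (M.X t₀ ω) ∂(M.P x) := by
  by_cases hx : x ∈ A s
  · rw [survProb_of_mem hA s t₀ hx]
    simpa using integral_nonneg fun ω => h0 _
  have hpos := hA.survProb_pos s t₀ hx
  have h := integral_mono_measure (hC.minorization s x hx) (ae_of_all _ h0)
    (integrable_of_abs_le hφ hK)
  rw [integral_smul_measure, integral_map (M.measurable_coord t₀).aemeasurable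
    hφ.aestronglyMeasurable, ProbabilityTheory.cond, integral_smul_measure,
    ENNReal.toReal_ofReal hC.c₁_pos.le, ENNReal.toReal_inv] at h
  change _ ≤ (M.survProb A s t₀ x)⁻¹ * _ at h
  rw [smul_eq_mul, inv_mul_eq_div, le_div_iff₀ hpos] at h
  linarith

theorem ChampagnatVillemonais.comparison_integral (hA : M.IsMovingBoundary A)
    (hC : M.ChampagnatVillemonais A ν t₀ c₁ c₂) (s t : I) (x : E) :
    c₂ * M.survProb A s t x ≤ ∫ y, M.survProb A s t y ∂(ν s) := by
  by_cases hx : x ∈ A s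
  · rw [survProb_of_mem hA s t hx, mul_zero]
    exact integral_nonneg fun y => survProb_nonneg _ _ _
  refine (hC.comparison s t x hx).trans_eq ?_
  rw [measureReal_def, Measure.bind_apply (hA.measurableSet_surv s t) M.P.aemeasurable]
  exact (integral_toReal (M.P.measurable_coe (hA.measurableSet_surv s t)).aemeasurable
    (ae_of_all _ fun y => measure_lt_top _ _)).symm

theorem ChampagnatVillemonais.comparison_supSurv (hA : M.IsMovingBoundary A)
    (hC : M.ChampagnatVillemonais A ν t₀ c₁ c₂) (s t : I) :
    c₂ * M.supSurv A s t ≤ ∫ y, M.survProb A s t y ∂(ν s) := by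
  have := hC.nonempty s
  rw [← le_div_iff₀' hC.c₂_pos]
  exact ciSup_le fun y => (le_div_iff₀' hC.c₂_pos).2 (hC.comparison_integral hA s t y)

theorem ChampagnatVillemonais.integral_survProb_le (hA : M.IsMovingBoundary A)
    (hC : M.ChampagnatVillemonais A ν t₀ c₁ c₂) (s t : I) :
    ∫ y, M.survProb A s t y ∂(ν s) ≤ M.supSurv A s t := by
  have := hC.isProbabilityMeasure s
  refine (integral_mono (hA.integrable_survProb s t (ν s)) (integrable_const _)
    fun y => survProb_le_supSurv hA s t y).trans ?_
  simp

theorem ChampagnatVillemonais.supSurv_pos (hA : M.IsMovingBoundary A)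
    (hC : M.ChampagnatVillemonais A ν t₀ c₁ c₂) (s t : I) : 0 < M.supSurv A s t := by
  obtain ⟨y⟩ := hC.nonempty s
  exact (hA.survProb_pos s t y.2).trans_le (survProb_le_supSurv hA s t y)

theorem ChampagnatVillemonais.integral_survProb_pos (hA : M.IsMovingBoundary A)
    (hC : M.ChampagnatVillemonais A ν t₀ c₁ c₂) (s t : I) :
    0 < ∫ y, M.survProb A s t y ∂(ν s) :=
  (_root_.mul_pos hC.c₂_pos (hC.supSurv_pos hA s t)).trans_le (hC.comparison_supSurv hA s t)

theorem ChampagnatVillemonais.c₂_le_one (hA : M.IsMovingBoundary A)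
    (hC : M.ChampagnatVillemonais A ν t₀ c₁ c₂) : c₂ ≤ 1 := by
  have h := (hC.comparison_supSurv hA 0 0).trans (hC.integral_survProb_le hA 0 0)
  nlinarith [hC.supSurv_pos hA 0 0]

theorem ChampagnatVillemonais.c₁_le_one (hA : M.IsMovingBoundary A)
    (hC : M.ChampagnatVillemonais A ν t₀ c₁ c₂) : c₁ ≤ 1 := by
  obtain ⟨x, hx⟩ := hC.nonempty 0
  have := hC.isProbabilityMeasure (0 + t₀)
  have h := hC.minorization_integral hA 0 x (φ := fun _ => 1) measurable_const
    (fun _ => zero_le_one) (fun _ => (abs_one).le)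
  have h1 : c₁ * M.survProb A 0 t₀ x ≤ M.survProb A 0 t₀ x := by
    simpa only [integral_const, probReal_univ, smul_eq_mul, mul_one,
      measureReal_restrict_apply_univ] using! h
  nlinarith [hA.survProb_pos 0 t₀ hx]

theorem ChampagnatVillemonais.mul_le_one (hA : M.IsMovingBoundary A)
    (hC : M.ChampagnatVillemonais A ν t₀ c₁ c₂) : c₁ * c₂ ≤ 1 :=
  mul_le_one₀ (hC.c₁_le_one hA) hC.c₂_pos.le (hC.c₂_le_one hA)

/-- Minorization replaces the law of `X_{t₀}` by `ν`, and comparison replaces the `ν`-average by the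
supremum. -/
theorem ChampagnatVillemonais.le_survProb_add (hA : M.IsMovingBoundary A)
    (hC : M.ChampagnatVillemonais A ν t₀ c₁ c₂) (s t : I) (x : E) :
    c₁ * c₂ * M.supSurv A (s + t₀) t * M.survProb A s t₀ x ≤ M.survProb A s (t₀ + t) x := by
  rw [survProb_add hA]
  refine le_trans ?_ (hC.minorization_integral hA s x (hA.measurable_survProb (s + t₀) t)
    (survProb_nonneg _ _) (abs_survProb_le_one _ _))
  have h := mul_le_mul_of_nonneg_left (hC.comparison_supSurv hA (s + t₀) t)
    (_root_.mul_nonneg hC.c₁_pos.le (survProb_nonneg (M := M) (A := A) s t₀ x))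
  linarith

/-- Survival for a further time `r` is uniformly comparable to its supremum, once a time `t₀` has
elapsed. -/
theorem ChampagnatVillemonais.le_survProb_add_of_le (hA : M.IsMovingBoundary A)
    (hC : M.ChampagnatVillemonais A ν t₀ c₁ c₂) (s : I) {T : I} (hT : t₀ ≤ T) (r : I) (x : E) :
    c₁ * c₂ * M.supSurv A (s + T) r * M.survProb A s T x ≤ M.survProb A s (T + r) x := by
  obtain ⟨u, rfl⟩ := exists_add_of_le hT
  -- The process runs freely for time `u`, so that minorization is used on the last stretch of
  -- length `t₀` before `T`.
  rw [add_comm t₀ u, add_assoc u t₀ r, survProb_add hA s u, survProb_add hA s u,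
    ← integral_const_mul]
  have hi : ∀ t, Integrable (fun ω => M.survProb A (s + u) t (M.X u ω))
      ((M.P x).restrict (M.surv A s u)) := fun t => integrable_of_abs_le
    ((hA.measurable_survProb _ _).comp (M.measurable_coord u)) fun _ => abs_survProb_le_one _ _ _
  refine integral_mono ((hi _).const_mul _) (hi _) fun ω => ?_
  rw [← add_assoc]
  exact hC.le_survProb_add hA (s + u) r (M.X u ω)

/-- With `φ = ψ h` this is the Doeblin minorization given survival up to `t₀ + T`: the conditional
law of `X_{t₀}` dominates `c₁ c₂` times `ν` reweighted by `h`. It holds because survival up to `t₀ +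
T` has probability at most that up to `t₀` times `sup h`, and `c₂ sup h ≤ ν(h)`. -/
theorem ChampagnatVillemonais.le_survProb_step (hA : M.IsMovingBoundary A)
    (hC : M.ChampagnatVillemonais A ν t₀ c₁ c₂) (s : I) (x : E) {h φ : E → ℝ} (T : I)
    (hh : h = M.survProb A (s + t₀) T)
    (hφ : Measurable φ) (h0 : ∀ y, 0 ≤ φ y) {K : ℝ} (hK : ∀ y, |φ y| ≤ K) :
    c₁ * c₂ * (∫ y, φ y ∂(ν (s + t₀))) / (∫ y, h y ∂(ν (s + t₀))) * M.survProb A s (t₀ + T) x ≤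
      ∫ ω in M.surv A s t₀, φ (M.X t₀ ω) ∂(M.P x) := by
  subst hh
  refine le_trans ?_ (hC.minorization_integral hA s x hφ h0 hK)
  have hN := hC.integral_survProb_pos hA (s + t₀) T
  have hφ0 : 0 ≤ ∫ y, φ y ∂(ν (s + t₀)) := integral_nonneg h0
  have h1 : c₂ * M.survProb A s (t₀ + T) x ≤
      M.survProb A s t₀ x * ∫ y, M.survProb A (s + t₀) T y ∂(ν (s + t₀)) := by
    calc c₂ * M.survProb A s (t₀ + T) x
        ≤ c₂ * (M.survProb A s t₀ x * M.supSurv A (s + t₀) T) :=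
          mul_le_mul_of_nonneg_left (survProb_add_le hA s t₀ T x) hC.c₂_pos.le
      _ = M.survProb A s t₀ x * (c₂ * M.supSurv A (s + t₀) T) := by ring
      _ ≤ _ := mul_le_mul_of_nonneg_left (hC.comparison_supSurv hA _ _) (survProb_nonneg _ _ _)
  rw [div_mul_eq_mul_div, div_le_iff₀ hN]
  have := mul_le_mul_of_nonneg_left h1 (_root_.mul_nonneg hC.c₁_pos.le hφ0)
  linarith

/-- Contraction of the conditioned process: after `n` steps of length `t₀`, the probabilities of
surviving for a further time `r` differ by at most `(1 - c₁ c₂) ^ n` times their supremum. -/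
theorem ChampagnatVillemonais.exists_survProb_bounds (hA : M.IsMovingBoundary A)
    (hC : M.ChampagnatVillemonais A ν t₀ c₁ c₂) (n : ℕ) (s T r : I) (hT : n • t₀ ≤ T) :
    ∃ m, 0 ≤ m ∧ ∀ x, m * M.survProb A s T x ≤ M.survProb A s (T + r) x ∧
      M.survProb A s (T + r) x ≤
        (m + (1 - c₁ * c₂) ^ n * M.supSurv A (s + T) r) * M.survProb A s T x := by
  induction n generalizing s T with
  | zero =>
    refine ⟨0, le_rfl, fun x => ⟨by simpa using survProb_nonneg _ _ _, ?_⟩⟩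
    have := survProb_add_le hA s T r x
    simpa [mul_comm] using this
  | succ n ih =>
    rw [succ_nsmul'] at hT
    obtain ⟨u, rfl⟩ := exists_add_of_le (le_self_add.trans hT)
    obtain ⟨m, hm0, hm⟩ := ih (s + t₀) u (le_of_add_le_add_left hT)
    -- Peeling the first step moves `s` to `s + t₀` but keeps the end time `s + T`, so the supremum
    -- in `δ` is unchanged.
    rw [add_assoc s t₀ u] at hm
    set δ := (1 - c₁ * c₂) ^ n * M.supSurv A (s + (t₀ + u)) r with hδ
    set h := M.survProb A (s + t₀) u with hh
    set g := M.survProb A (s + t₀) (u + r) with hg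
    have := hC.isProbabilityMeasure (s + t₀)
    have hhm : Measurable h := hA.measurable_survProb _ _
    have hgm : Measurable g := hA.measurable_survProb _ _
    have hhb : ∀ y, |h y| ≤ 1 := abs_survProb_le_one _ _
    have hgb : ∀ y, |g y| ≤ 1 := abs_survProb_le_one _ _
    have hhi : Integrable h (ν (s + t₀)) := integrable_of_abs_le hhm hhb
    have hgi : Integrable g (ν (s + t₀)) := integrable_of_abs_le hgm hgb
    have hhi' : ∀ x, Integrable (fun ω => h (M.X t₀ ω)) ((M.P x).restrict (M.surv A s t₀)) :=
      fun x => integrable_of_abs_le (hhm.comp (M.measurable_coord t₀)) fun _ => hhb _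
    have hgi' : ∀ x, Integrable (fun ω => g (M.X t₀ ω)) ((M.P x).restrict (M.surv A s t₀)) :=
      fun x => integrable_of_abs_le (hgm.comp (M.measurable_coord t₀)) fun _ => hgb _
    have hN := hC.integral_survProb_pos hA (s + t₀) u
    rw [← hh] at hN
    -- The common component of mass `c₁ c₂` contributes this same ratio from every starting point.
    set a := (∫ y, g y ∂(ν (s + t₀))) / ∫ y, h y ∂(ν (s + t₀)) with ha
    have hS : ∀ x, M.survProb A s (t₀ + u) x =
        ∫ ω in M.surv A s t₀, h (M.X t₀ ω) ∂(M.P x) := fun x => survProb_add hA s t₀ u x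
    have hS' : ∀ x, M.survProb A s (t₀ + u + r) x =
        ∫ ω in M.surv A s t₀, g (M.X t₀ ω) ∂(M.P x) := fun x => by
      rw [add_assoc]; exact survProb_add hA s t₀ (u + r) x
    have hma : m ≤ a := by
      rw [ha, le_div_iff₀ hN, ← integral_const_mul]
      exact integral_mono (hhi.const_mul m) hgi
        fun y => (hm y).1
    -- Both ends of `[m, m + δ]` move towards `a` by the fraction `c₁ c₂`, leaving length `(1 - c₁
    -- c₂) δ`. The step inequality is applied to `g - m h` and to `(m + δ) h - g`.
    refine ⟨m + c₁ * c₂ * (a - m), by nlinarith [hC.mul_pos], fun x => ⟨?_, ?_⟩⟩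
    · have key := hC.le_survProb_step hA s x (h := h) (φ := fun y => g y - m * h y) u hh
        (hgm.sub (hhm.const_mul m)) (fun y => sub_nonneg.2 (hm y).1) (K := 1 + m * 1)
        (fun y => (abs_sub _ _).trans (add_le_add (hgb y) (by
          rw [abs_mul, abs_of_nonneg hm0]
          exact mul_le_mul_of_nonneg_left (hhb y) hm0)))
      rw [integral_sub hgi (hhi.const_mul m),
        integral_sub (hgi' x)
          ((hhi' x).const_mul m),
        integral_const_mul, integral_const_mul, ← hS, ← hS', mul_div_assoc, sub_div,
        mul_div_assoc m, div_self hN.ne', mul_one] at key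
      linarith
    · have key := hC.le_survProb_step hA s x (h := h) (φ := fun y => (m + δ) * h y - g y) u hh
        ((hhm.const_mul _).sub hgm) (fun y => sub_nonneg.2 (hm y).2) (K := |m + δ| * 1 + 1)
        (fun y => (abs_sub _ _).trans (add_le_add (by
          rw [abs_mul]
          exact mul_le_mul_of_nonneg_left (hhb y) (abs_nonneg _)) (hgb y)))
      rw [integral_sub (hhi.const_mul _) hgi,
        integral_sub ((hhi' x).const_mul _)
          (hgi' x),
        integral_const_mul, integral_const_mul, ← hS, ← hS', mul_div_assoc, sub_div,
        mul_div_assoc (m + δ), div_self hN.ne', mul_one, ← ha] at key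
      have e : m + c₁ * c₂ * (a - m) + (1 - c₁ * c₂) ^ (n + 1) * M.supSurv A (s + (t₀ + u)) r =
          (m + δ) - c₁ * c₂ * (m + δ - a) := by rw [hδ]; ring
      rw [e]
      linarith

end Contraction

end MarkovFamily

/-! ### Convergence of conditional laws and the profile `η` -/

namespace MarkovFamily

section Profile

set_option linter.unusedSectionVars false

variable {I : Type} [AddCommMonoid I] [ConditionallyCompleteLinearOrderBot I]
  [IsOrderedCancelAddMonoid I] [CanonicallyOrderedAdd I] [Sub I] [OrderedSub I] [NoMaxOrder I]
  {E : Type*} [MeasurableSpace E] {Ω : Type*} [MeasurableSpace Ω]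
  {M : MarkovFamily I E Ω} {A : I → Set E} {ν : I → Measure E} {t₀ : I} {c₁ c₂ : ℝ}

theorem integral_condPathLaw (M : MarkovFamily I E Ω) (A : I → Set E) (s t r : I) (x : E)
    {g : (Set.Icc (0 : I) t → E) → ℝ} (hg : Measurable g) :
    ∫ p, g p ∂(M.condPathLaw A s x t r) =
      (∫ ω in M.surv A s r, g (M.path t ω) ∂(M.P x)) / M.survProb A s r x := by
  rw [condPathLaw, integral_map (M.measurable_path t).aemeasurable hg.aestronglyMeasurable,
    ProbabilityTheory.cond, integral_smul_measure, ENNReal.toReal_inv, smul_eq_mul,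
    inv_mul_eq_div]
  rfl

theorem IsMovingBoundary.isProbabilityMeasure_condPathLaw (hA : M.IsMovingBoundary A)
    (s t r : I) {x : E} (hx : x ∈ (A s)ᶜ) : IsProbabilityMeasure (M.condPathLaw A s x t r) := by
  have := cond_isProbabilityMeasure (hA.survive s r x hx).ne'
  exact Measure.isProbabilityMeasure_map (M.measurable_path t).aemeasurable

/-- Both `a F'` and `F a'` lie between `m a F` and `(m + ε) a F`, so they differ by at most `ε a F ≤
d a F'`. -/
theorem abs_div_sub_div_le {a F a' F' m ε d : ℝ} (hF : 0 < F) (hF' : 0 < F') (ha : 0 ≤ a)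
    (h1 : m * a ≤ a') (h2 : a' ≤ (m + ε) * a) (h3 : m * F ≤ F')
    (h4 : F' ≤ (m + ε) * F) (hd : ε * F ≤ d * F') : |a / F - a' / F'| ≤ d * (a / F) := by
  have e : a / F - a' / F' = (a * F' - F * a') / (F * F') := by
    rw [div_sub_div _ _ hF.ne' hF'.ne']
  have e2 : d * (a / F) = (a * (d * F')) / (F * F') := by
    field_simp
  rw [e, e2, abs_div, abs_of_pos (mul_pos hF hF')]
  refine div_le_div_of_nonneg_right ?_ (mul_pos hF hF').le
  have h5 := mul_le_mul_of_nonneg_left hd ha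
  refine (abs_le.2 ⟨?_, ?_⟩ : _ ≤ a * (ε * F)).trans h5
  · nlinarith [mul_le_mul_of_nonneg_left h3 ha, mul_le_mul_of_nonneg_left h2 hF.le]
  · nlinarith [mul_le_mul_of_nonneg_left h4 ha, mul_le_mul_of_nonneg_left h1 hF.le]

/-- The conditional laws of the path on `[0,t]`, given survival up to `t + T` and `t + T + r`,
are exponentially close in `T`. -/
theorem ChampagnatVillemonais.abs_integral_condPathLaw_sub_le (hA : M.IsMovingBoundary A)
    (hC : M.ChampagnatVillemonais A ν t₀ c₁ c₂) (n : ℕ) (s t : I) {T : I} (hT : n • t₀ ≤ T)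
    (r : I) {x : E} (hx : x ∈ (A s)ᶜ) {g : (Set.Icc (0 : I) t → E) → ℝ} (hg : Measurable g)
    (hg0 : ∀ p, 0 ≤ g p) (hg1 : ∀ p, g p ≤ 1) :
    |∫ p, g p ∂(M.condPathLaw A s x t (t + T)) -
      ∫ p, g p ∂(M.condPathLaw A s x t (t + (T + r)))| ≤ (1 - c₁ * c₂) ^ n / (c₁ * c₂) := by
  have hc := hC.mul_pos
  have hc1 := hC.mul_le_one hA
  have hgabs : ∀ p, |g p| ≤ 1 := fun p => abs_le.2 ⟨by linarith [hg0 p], hg1 p⟩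
  -- For `n = 0` the lower bound needing `t₀ ≤ T` is unavailable, but the trivial bound `1 ≤ 1 / (c₁
  -- c₂)` suffices.
  rcases Nat.eq_zero_or_pos n with rfl | hn
  · have hb : ∀ u, 0 ≤ ∫ p, g p ∂(M.condPathLaw A s x t u) ∧
        ∫ p, g p ∂(M.condPathLaw A s x t u) ≤ 1 := fun u => by
      have := hA.isProbabilityMeasure_condPathLaw s t u hx
      refine ⟨integral_nonneg hg0, ?_⟩
      refine (integral_mono (integrable_of_abs_le hg hgabs) (integrable_const 1) hg1).trans ?_
      simp
    have h1 : 1 ≤ 1 / (c₁ * c₂) := (one_le_div hc).2 hc1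
    have h2 := hb (t + T)
    have h3 := hb (t + (T + r))
    rw [pow_zero]
    exact (abs_le.2 ⟨by linarith, by linarith⟩ : _ ≤ (1 : ℝ)).trans h1
  obtain ⟨m, hm0, hm⟩ := hC.exists_survProb_bounds hA n (s + t) T r hT
  have hT' : t₀ ≤ T := le_trans (le_self_nsmul zero_le hn.ne') hT
  have hm' := hC.le_survProb_add_of_le hA (s + t) hT' r
  have hΦ := hC.supSurv_pos hA (s + t + T) r
  set Φ := M.supSurv A (s + t + T) r
  have hgm := hg.comp (M.measurable_path t)
  have hf : ∀ u, Measurable fun ω => M.survProb A (s + t) u (M.X t ω) := fun u =>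
    (hA.measurable_survProb _ _).comp (M.measurable_coord t)
  have hI : ∀ u, Integrable (fun ω => M.survProb A (s + t) u (M.X t ω))
      ((M.P x).restrict (M.surv A s t)) := fun u =>
    integrable_of_abs_le (hf u) fun _ => abs_survProb_le_one _ _ _
  have hJ : ∀ u, Integrable (fun ω => g (M.path t ω) * M.survProb A (s + t) u (M.X t ω))
      ((M.P x).restrict (M.surv A s t)) := fun u =>
    integrable_of_abs_le (hgm.mul (hf u)) (K := 1) fun ω => by
      rw [abs_mul]
      exact mul_le_one₀ (hgabs _) (abs_nonneg _) (abs_survProb_le_one _ _ _)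
  rw [integral_condPathLaw M A s t _ x hg, integral_condPathLaw M A s t _ x hg,
    setIntegral_surv_add hA s t _ x hg, setIntegral_surv_add hA s t _ x hg]
  have hF := hA.survProb_pos s (t + T) hx
  have hF' := hA.survProb_pos s (t + (T + r)) hx
  have haF : ∫ ω in M.surv A s t, g (M.path t ω) * M.survProb A (s + t) T (M.X t ω) ∂(M.P x) ≤
      M.survProb A s (t + T) x := by
    rw [survProb_add hA]
    exact integral_mono (hJ T) (hI T) fun ω =>
      mul_le_of_le_one_left (survProb_nonneg _ _ _) (hg1 _)
  have ha : 0 ≤ ∫ ω in M.surv A s t, g (M.path t ω) * M.survProb A (s + t) T (M.X t ω) ∂(M.P x) :=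
    integral_nonneg fun ω => mul_nonneg (hg0 _) (survProb_nonneg _ _ _)
  have hpow : 0 ≤ (1 - c₁ * c₂) ^ n := pow_nonneg (by linarith) n
  have hd : 0 ≤ (1 - c₁ * c₂) ^ n / (c₁ * c₂) := div_nonneg hpow hc.le
  refine (abs_div_sub_div_le (m := m) (ε := (1 - c₁ * c₂) ^ n * Φ) hF hF' ha ?_ ?_ ?_ ?_ ?_).trans
      (mul_le_of_le_one_right hd ((div_le_one hF).2 haF))
  · rw [← integral_const_mul]
    refine integral_mono ((hJ _).const_mul _) (hJ _) fun ω => ?_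
    have := mul_le_mul_of_nonneg_left (hm (M.X t ω)).1 (hg0 (M.path t ω))
    simp only; linarith
  · rw [← integral_const_mul]
    refine integral_mono (hJ _) ((hJ _).const_mul _) fun ω => ?_
    have := mul_le_mul_of_nonneg_left (hm (M.X t ω)).2 (hg0 (M.path t ω))
    simp only; linarith
  · rw [survProb_add hA, survProb_add hA, ← integral_const_mul]
    exact integral_mono ((hI _).const_mul _) (hI _) fun ω => (hm (M.X t ω)).1
  · rw [survProb_add hA, survProb_add hA, ← integral_const_mul]
    exact integral_mono (hI _) ((hI _).const_mul _) fun ω => (hm (M.X t ω)).2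
  -- The absolute oscillation `(1 - c₁ c₂)^n Φ` is divided by the lower bound `c₁ c₂ Φ`; `Φ`
  -- cancels.
  · have : c₁ * c₂ * Φ * M.survProb A s (t + T) x ≤ M.survProb A s (t + (T + r)) x := by
      rw [survProb_add hA, survProb_add hA, ← integral_const_mul]
      exact integral_mono ((hI _).const_mul _) (hI _) fun ω => hm' (M.X t ω)
    have h2 := mul_le_mul_of_nonneg_left this hd
    refine le_trans (le_of_eq ?_) h2
    rw [mul_assoc (c₁ * c₂), ← mul_assoc, div_mul_cancel₀ _ hc.ne', mul_assoc]

theorem ChampagnatVillemonais.div_integral_survProb_le (hA : M.IsMovingBoundary A)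
    (hC : M.ChampagnatVillemonais A ν t₀ c₁ c₂) (s T : I) (x : E) :
    M.survProb A s T x / ∫ y, M.survProb A s T y ∂(ν s) ≤ 1 / c₂ := by
  rw [div_le_div_iff₀ (hC.integral_survProb_pos hA s T) hC.c₂_pos]
  linarith [hC.comparison_integral hA s T x]

theorem div_integral_survProb_nonneg (s T : I) (x : E) :
    0 ≤ M.survProb A s T x / ∫ y, M.survProb A s T y ∂(ν s) :=
  div_nonneg (survProb_nonneg _ _ _) (integral_nonneg fun _ => survProb_nonneg _ _ _)

/-- The same comparison of ratios, with the `ν s`-average as denominator; the extra `1 / c₂` bounds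
the normalised survival probability. -/
theorem ChampagnatVillemonais.abs_div_integral_survProb_sub_le (hA : M.IsMovingBoundary A)
    (hC : M.ChampagnatVillemonais A ν t₀ c₁ c₂) {n : ℕ} (hn : n ≠ 0) (s : I) {T : I}
    (hT : n • t₀ ≤ T) (r : I) (x : E) :
    |M.survProb A s T x / ∫ y, M.survProb A s T y ∂(ν s) -
      M.survProb A s (T + r) x / ∫ y, M.survProb A s (T + r) y ∂(ν s)| ≤
      (1 - c₁ * c₂) ^ n / (c₁ * c₂) * (1 / c₂) := by
  have hc := hC.mul_pos
  have hc1 := hC.mul_le_one hA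
  have hνs := hC.isProbabilityMeasure s
  obtain ⟨m, hm0, hm⟩ := hC.exists_survProb_bounds hA n s T r hT
  have hm' := hC.le_survProb_add_of_le hA s (le_trans (le_self_nsmul zero_le hn) hT) r
  have hΦ := hC.supSurv_pos hA (s + T) r
  set Φ := M.supSurv A (s + T) r
  have hF := hC.integral_survProb_pos hA s T
  have hF' := hC.integral_survProb_pos hA s (T + r)
  have hI : ∀ u, Integrable (M.survProb A s u) (ν s) := fun u => hA.integrable_survProb s u _
  have hpow : 0 ≤ (1 - c₁ * c₂) ^ n := pow_nonneg (by linarith) n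
  have hd : 0 ≤ (1 - c₁ * c₂) ^ n / (c₁ * c₂) := div_nonneg hpow hc.le
  have h := hC.div_integral_survProb_le hA s T x
  refine le_trans ?_ (mul_le_mul_of_nonneg_left h hd)
  have h3 : m * ∫ y, M.survProb A s T y ∂(ν s) ≤ ∫ y, M.survProb A s (T + r) y ∂(ν s) := by
    rw [← integral_const_mul]
    exact integral_mono ((hI _).const_mul _) (hI _) fun y => (hm y).1
  have h4 : ∫ y, M.survProb A s (T + r) y ∂(ν s) ≤
      (m + (1 - c₁ * c₂) ^ n * Φ) * ∫ y, M.survProb A s T y ∂(ν s) := by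
    rw [← integral_const_mul]
    exact integral_mono (hI _) ((hI _).const_mul _) fun y => (hm y).2
  have h5 : c₁ * c₂ * Φ * ∫ y, M.survProb A s T y ∂(ν s) ≤
      ∫ y, M.survProb A s (T + r) y ∂(ν s) := by
    rw [← integral_const_mul]
    exact integral_mono ((hI _).const_mul _) (hI _) fun y => hm' y
  refine abs_div_sub_div_le hF hF' (survProb_nonneg _ _ _)
    (hm x).1 (hm x).2 h3 h4 ?_
  refine le_trans (le_of_eq ?_) (mul_le_mul_of_nonneg_left h5 hd)
  rw [mul_assoc (c₁ * c₂), ← mul_assoc, div_mul_cancel₀ _ hc.ne', mul_assoc]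

theorem ChampagnatVillemonais.tendsto_pow (hA : M.IsMovingBoundary A)
    (hC : M.ChampagnatVillemonais A ν t₀ c₁ c₂) :
    Tendsto (fun n : ℕ => (1 - c₁ * c₂) ^ n) atTop (𝓝 0) :=
  tendsto_pow_atTop_nhds_zero_of_lt_one (by linarith [hC.mul_le_one hA]) (by linarith [hC.mul_pos])

/-- `η s` is the limit of the survival probabilities, normalised by their `ν s`-average. -/
def IsNormalizedLimit (M : MarkovFamily I E Ω) (A : I → Set E) (ν : I → Measure E)
    (η : I → E → ℝ) : Prop :=
  ∀ s x, Tendsto (fun T => M.survProb A s T x / ∫ y, M.survProb A s T y ∂(ν s)) atTop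
    (𝓝 (η s x))

theorem ChampagnatVillemonais.exists_isNormalizedLimit (hA : M.IsMovingBoundary A)
    (hC : M.ChampagnatVillemonais A ν t₀ c₁ c₂) : ∃ η, M.IsNormalizedLimit A ν η := by
  have h : ∀ s x, ∃ l, Tendsto (fun T => M.survProb A s T x / ∫ y, M.survProb A s T y ∂(ν s))
      atTop (𝓝 l) := fun s x => by
    refine cauchySeq_tendsto_of_complete (Metric.cauchySeq_iff'.2 fun ε hε => ?_)
    have h0 : Tendsto (fun n : ℕ => (1 - c₁ * c₂) ^ n / (c₁ * c₂) * (1 / c₂)) atTop (𝓝 0) := by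
      simpa using ((hC.tendsto_pow hA).div_const (c₁ * c₂)).mul_const (1 / c₂)
    obtain ⟨n, hn, hn'⟩ := ((h0.eventually_lt_const hε).and (eventually_ne_atTop 0)).exists
    refine ⟨n • t₀, fun T hT => ?_⟩
    obtain ⟨r, rfl⟩ := exists_add_of_le hT
    rw [dist_comm]
    exact (hC.abs_div_integral_survProb_sub_le hA hn' s le_rfl r x).trans_lt hn
  choose η hη using h
  exact ⟨η, hη⟩

namespace IsNormalizedLimit

variable {η : I → E → ℝ}

theorem measurable [(atTop : Filter I).IsCountablyGenerated] (hη : M.IsNormalizedLimit A ν η)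
    (hA : M.IsMovingBoundary A) (s : I) : Measurable (η s) :=
  measurable_of_tendsto_metrizable' atTop
    (fun T => (hA.measurable_survProb s T).div_const _) (tendsto_pi_nhds.2 fun x => hη s x)

theorem nonneg (hη : M.IsNormalizedLimit A ν η) (s : I) (x : E) : 0 ≤ η s x :=
  ge_of_tendsto' (hη s x) fun T => div_integral_survProb_nonneg s T x

theorem le (hη : M.IsNormalizedLimit A ν η) (hA : M.IsMovingBoundary A)
    (hC : M.ChampagnatVillemonais A ν t₀ c₁ c₂) (s : I) (x : E) : η s x ≤ 1 / c₂ :=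
  le_of_tendsto' (hη s x) fun T => hC.div_integral_survProb_le hA s T x

theorem eq_zero (hη : M.IsNormalizedLimit A ν η) (hA : M.IsMovingBoundary A) (s : I) {x : E}
    (hx : x ∈ A s) : η s x = 0 := by
  refine tendsto_nhds_unique (hη s x) ?_
  simp [survProb_of_mem hA s _ hx]

/-- The numerator is at least `c₁ c₂ f_{s,t₀}(x)` times `sup f_{s+t₀,t}`, and the `ν s`-average
below is at most that supremum. This gives positivity of `η`. -/
theorem ge (hη : M.IsNormalizedLimit A ν η) (hA : M.IsMovingBoundary A)
    (hC : M.ChampagnatVillemonais A ν t₀ c₁ c₂) (s : I) (x : E) :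
    c₁ * c₂ * M.survProb A s t₀ x ≤ η s x := by
  refine ge_of_tendsto (hη s x) ((eventually_ge_atTop t₀).mono fun T hT => ?_)
  obtain ⟨t, rfl⟩ := exists_add_of_le hT
  have hν := hC.isProbabilityMeasure s
  rw [le_div_iff₀ (hC.integral_survProb_pos hA s _)]
  have h1 := hC.le_survProb_add hA s t x
  have h2 : ∫ y, M.survProb A s (t₀ + t) y ∂(ν s) ≤ M.supSurv A (s + t₀) t := by
    refine (integral_mono (hA.integrable_survProb s _ _) (integrable_const _) fun y =>
      (survProb_add_le hA s t₀ t y).trans (mul_le_of_le_one_left (supSurv_nonneg _ _)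
        (survProb_le_one _ _ _))).trans ?_
    simp
  have h3 := mul_le_mul_of_nonneg_left h2
    (mul_nonneg hC.mul_pos.le (survProb_nonneg (M := M) (A := A) s t₀ x))
  linarith

theorem pos (hη : M.IsNormalizedLimit A ν η) (hA : M.IsMovingBoundary A)
    (hC : M.ChampagnatVillemonais A ν t₀ c₁ c₂) (s : I) {x : E} (hx : x ∈ (A s)ᶜ) : 0 < η s x :=
  (_root_.mul_pos hC.mul_pos (hA.survProb_pos s t₀ hx)).trans_le (hη.ge hA hC s x)

theorem isSurvivalProfile [(atTop : Filter I).IsCountablyGenerated]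
    (hη : M.IsNormalizedLimit A ν η) (hA : M.IsMovingBoundary A)
    (hC : M.ChampagnatVillemonais A ν t₀ c₁ c₂) : M.IsSurvivalProfile A η where
  measurable := hη.measurable hA
  pos s x hx := hη.pos hA hC s hx
  bounded s := ⟨1 / c₂, fun x _ => hη.le hA hC s x⟩
  tendsto_ratio s x _ y hy := by
    refine ((hη s x).div (hη s y) (hη.pos hA hC s hy).ne').congr fun T => ?_
    exact div_div_div_cancel_right₀ (hC.integral_survProb_pos hA s T).ne' _ _

/-- Condition at time `t`, then use dominated convergence with bound `K / c₂`. The normaliser is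
independent of `x` and `g`, so it cancels in conditional expectations. -/
theorem tendsto_setIntegral [(atTop : Filter I).IsCountablyGenerated]
    (hη : M.IsNormalizedLimit A ν η) (hA : M.IsMovingBoundary A)
    (hC : M.ChampagnatVillemonais A ν t₀ c₁ c₂) (s t : I) (x : E)
    {g : (Set.Icc (0 : I) t → E) → ℝ} (hg : Measurable g) {K : ℝ} (hK : ∀ p, |g p| ≤ K) :
    Tendsto (fun T => (∫ ω in M.surv A s (t + T), g (M.path t ω) ∂(M.P x)) /
      ∫ y, M.survProb A (s + t) T y ∂(ν (s + t))) atTop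
      (𝓝 (∫ ω in M.surv A s t, g (M.path t ω) * η (s + t) (M.X t ω) ∂(M.P x))) := by
  have hgm := hg.comp (M.measurable_path t)
  have h : ∀ T, (∫ ω in M.surv A s (t + T), g (M.path t ω) ∂(M.P x)) /
      ∫ y, M.survProb A (s + t) T y ∂(ν (s + t)) =
      ∫ ω in M.surv A s t, g (M.path t ω) * (M.survProb A (s + t) T (M.X t ω) /
        ∫ y, M.survProb A (s + t) T y ∂(ν (s + t))) ∂(M.P x) := fun T => by
    rw [setIntegral_surv_add hA s t T x hg, ← integral_div]
    simp only [mul_div_assoc]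
  simp only [h]
  refine tendsto_integral_filter_of_dominated_convergence (fun _ => K * (1 / c₂))
    (.of_forall fun T => ?_) (.of_forall fun T => ae_of_all _ fun ω => ?_) (integrable_const _)
    (ae_of_all _ fun ω => (hη (s + t) (M.X t ω)).const_mul _)
  · exact (hgm.mul (((hA.measurable_survProb _ _).comp
      (M.measurable_coord t)).div_const _)).aestronglyMeasurable
  · rw [norm_mul, Real.norm_eq_abs, Real.norm_of_nonneg (div_integral_survProb_nonneg _ _ _)]
    exact mul_le_mul (hK _) (hC.div_integral_survProb_le hA _ _ _)
      (div_integral_survProb_nonneg _ _ _) ((abs_nonneg _).trans (hK (M.path t ω)))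

/-- `η` is an eigenfunction of the killed semigroup, up to a positive factor. -/
theorem exists_setIntegral_eq [(atTop : Filter I).IsCountablyGenerated]
    (hη : M.IsNormalizedLimit A ν η) (hA : M.IsMovingBoundary A)
    (hC : M.ChampagnatVillemonais A ν t₀ c₁ c₂) (s t : I) :
    ∃ l, 0 < l ∧ ∀ x, ∫ ω in M.surv A s t, η (s + t) (M.X t ω) ∂(M.P x) = l * η s x := by
  obtain ⟨x₀, hx₀⟩ := hC.nonempty s
  have hm := (hη.measurable hA (s + t)).comp (M.measurable_coord t)
  have hJ : ∀ x, Tendsto (fun T => M.survProb A s (t + T) x /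
      ∫ y, M.survProb A (s + t) T y ∂(ν (s + t))) atTop
      (𝓝 (∫ ω in M.surv A s t, η (s + t) (M.X t ω) ∂(M.P x))) := fun x => by
    have h := hη.tendsto_setIntegral hA hC s t x (g := fun _ => 1) measurable_const (K := 1)
      (fun _ => abs_one.le)
    simp only [one_mul] at h
    refine h.congr fun T => ?_
    simp [survProb]
  have ht : Tendsto (fun T => t + T) atTop atTop :=
    tendsto_atTop_mono (fun _ => le_add_self) tendsto_id
  have hpos : 0 < ∫ ω in M.surv A s t, η (s + t) (M.X t ω) ∂(M.P x₀) := by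
    refine (_root_.mul_pos hC.mul_pos (hA.survProb_pos s (t + t₀) hx₀)).trans_le ?_
    rw [survProb_add hA, ← integral_const_mul]
    refine integral_mono ((integrable_of_abs_le ((hA.measurable_survProb _ _).comp
      (M.measurable_coord t)) fun _ => abs_survProb_le_one _ _ _).const_mul _)
      (integrable_of_abs_le hm (K := 1 / c₂) fun ω => ?_) fun ω => hη.ge hA hC _ _
    exact (abs_of_nonneg (hη.nonneg _ _)).trans_le (hη.le hA hC _ _)
  refine ⟨_, div_pos hpos (hη.pos hA hC s hx₀), fun x => ?_⟩
  rw [div_mul_eq_mul_div, eq_div_iff (hη.pos hA hC s hx₀).ne']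
  -- Before the limit, both products equal `f_{s,t+T}(x) f_{s,t+T}(x₀)` over the same two averages.
  refine tendsto_nhds_unique ((hJ x).mul ((hη s x₀).comp ht)) ?_
  refine ((hJ x₀).mul ((hη s x).comp ht)).congr fun T => ?_
  simp only [Function.comp_apply]
  ring

end IsNormalizedLimit

end Profile

end MarkovFamily

/-! ### Extension of consistent laws to infinite sequences -/

/-- If the finite dimensional laws of `Z`, under a sequence of measures, are those of a Markov
chain, then they extend to a law on infinite sequences. -/
theorem exists_measure_map_frestrictLe_eq {S Ω : Type*} [MeasurableSpace S] [MeasurableSpace Ω]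
    (K : ℕ → Kernel S S) [∀ n, IsMarkovKernel (K n)] (x₀ : S) (H : ℕ → Measure Ω)
    [∀ n, IsFiniteMeasure (H n)] (Z : ℕ → Ω → S) (hZ : ∀ n, Measurable (Z n))
    (h_zero : (H 0).map (Z 0) = Measure.dirac x₀)
    (h_succ : ∀ n (B : Set (Finset.Iic n → S)) (B' : Set S), MeasurableSet B → MeasurableSet B' →
      H (n + 1) ((fun ω (i : Finset.Iic n) => Z i ω) ⁻¹' B ∩ Z (n + 1) ⁻¹' B') =
        ∫⁻ ω in (fun ω (i : Finset.Iic n) => Z i ω) ⁻¹' B, K n (Z n ω) B' ∂(H n)) :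
    ∃ q : Measure (ℕ → S), IsProbabilityMeasure q ∧ ∀ n,
      q.map (Preorder.frestrictLe n) = (H n).map (fun ω (i : Finset.Iic n) => Z i ω) := by
  let κ : (n : ℕ) → Kernel (Finset.Iic n → S) S := fun n =>
    (K n).comap (fun w => w ⟨n, Finset.mem_Iic.2 le_rfl⟩) (measurable_pi_apply _)
  have hκ : ∀ n, IsMarkovKernel (κ n) := fun n => by dsimp only [κ]; infer_instance
  have hZ' : ∀ n : ℕ, Measurable fun ω (i : Finset.Iic n) => Z i ω := fun n => by fun_prop
  -- Ionescu-Tulcea requires no topology on `S`; each kernel looks only at the last coordinate.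
  refine ⟨Kernel.traj (X := fun _ => S) κ 0 fun _ => x₀, inferInstance, fun n => ?_⟩
  induction n with
  | zero =>
    rw [Kernel.traj_map_frestrictLe_apply, Kernel.partialTraj_self, Kernel.id_apply]
    have hc : Measurable fun (y : S) (_ : Finset.Iic 0) => y :=
      measurable_pi_lambda _ fun _ => measurable_id
    have h : (fun ω (i : Finset.Iic 0) => Z i ω) =
        (fun (y : S) (_ : Finset.Iic 0) => y) ∘ Z 0 := by
      ext ω i
      have : (i : ℕ) = 0 := Nat.le_zero.1 (Finset.mem_Iic.1 i.2)
      simp [this]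
    rw [h, ← Measure.map_map hc (hZ 0), h_zero, Measure.map_dirac' hc]
  | succ n ih =>
    have h1 := Kernel.partialTraj_compProd_eq_map_traj (X := fun _ => S) (κ := κ)
      (Nat.zero_le n) (x₀ := fun _ => x₀)
    rw [← Kernel.traj_map_frestrictLe_apply, ih] at h1
    have h2 : (H n).map (fun ω (i : Finset.Iic n) => Z i ω) ⊗ₘ κ n =
        (H (n + 1)).map fun ω => ((fun i : Finset.Iic n => Z i ω), Z (n + 1) ω) := by
      refine Measure.ext_prod fun {B B'} hB hB' => ?_
      rw [Measure.compProd_apply_prod hB hB',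
        setLIntegral_map hB (Kernel.measurable_coe _ hB') (hZ' n),
        Measure.map_apply ((hZ' n).prodMk (hZ _)) (hB.prod hB')]
      exact (h_succ n B B' hB hB').symm
    rw [h2] at h1
    let G : (Finset.Iic n → S) × S → (Finset.Iic (n + 1) → S) := fun p i =>
      if h : (i : ℕ) ≤ n then p.1 ⟨i, Finset.mem_Iic.2 h⟩ else p.2
    have hG : Measurable G := measurable_pi_lambda _ fun i => by
      by_cases h : (i : ℕ) ≤ n
      · simp only [G, h, dite_true]
        exact (measurable_pi_apply _).comp measurable_fst
      · simp only [G, h, dite_false]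
        exact measurable_snd
    have hi : ∀ i : Finset.Iic (n + 1), ¬ (i : ℕ) ≤ n → (i : ℕ) = n + 1 := fun i h => by
      have := Finset.mem_Iic.1 i.2
      omega
    have e1 : (Preorder.frestrictLe (n + 1) : (ℕ → S) → _) =
        G ∘ fun w => (Preorder.frestrictLe n w, w (n + 1)) := by
      ext w i
      by_cases h : (i : ℕ) ≤ n
      · simp [G, h]
      · simp [G, hi i h]
    have e2 : (fun ω (i : Finset.Iic (n + 1)) => Z i ω) =
        G ∘ fun ω => ((fun i : Finset.Iic n => Z i ω), Z (n + 1) ω) := by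
      ext ω i
      by_cases h : (i : ℕ) ≤ n
      · simp [G, h]
      · simp [G, hi i h]
    rw [e1, e2, ← Measure.map_map hG ((hZ' n).prodMk (hZ _)), h1,
      Measure.map_map hG ((Preorder.measurable_frestrictLe n).prodMk (measurable_pi_apply _))]

/-! ### Path measures weighted by `η` at the final time -/

namespace MarkovFamily

section Weighted

set_option linter.unusedSectionVars false

variable {I : Type} [AddCommMonoid I] [ConditionallyCompleteLinearOrderBot I]
  [IsOrderedCancelAddMonoid I] [CanonicallyOrderedAdd I] [Sub I] [OrderedSub I] [NoMaxOrder I]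
  {E : Type*} [MeasurableSpace E] {Ω : Type*} [MeasurableSpace Ω]
  {M : MarkovFamily I E Ω} {A : I → Set E} {ν : I → Measure E} {t₀ : I} {c₁ c₂ : ℝ}
  {η : I → E → ℝ}

theorem setLIntegral_shift (M : MarkovFamily I E Ω) (t : I) (x : E) {C : Set Ω}
    (hC : MeasurableSet[M.F t] C) {g : Ω → ℝ≥0∞} (hg : Measurable[⨆ t, M.F t] g) :
    ∫⁻ ω in C, g (M.shift t ω) ∂(M.P x) = ∫⁻ ω in C, ∫⁻ ω', g ω' ∂(M.P (M.X t ω)) ∂(M.P x) := by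
  have hle : (⨆ t, M.F t : MeasurableSpace Ω) ≤ _ := iSup_le fun t => M.F.le t
  have hshift : Measurable[_, ⨆ t, M.F t] (M.shift t) := by
    rw [measurable_iff_comap_le, MeasurableSpace.comap_iSup]
    exact iSup_le fun r => (measurable_iff_comap_le.1 (M.measurable_shift t r)).trans (M.F.le _)
  have hk : ∀ {f : Ω → ℝ≥0∞}, Measurable[⨆ t, M.F t] f →
      Measurable fun ω => ∫⁻ ω', f ω' ∂(M.P (M.X t ω)) := fun hf =>
    ((hf.mono hle le_rfl).lintegral_kernel (κ := M.P)).comp (M.measurable_coord t)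
  have hs : ∀ {f : Ω → ℝ≥0∞}, Measurable[⨆ t, M.F t] f →
      Measurable fun ω => f (M.shift t ω) := fun hf => hf.comp hshift
  refine Measurable.ennreal_induction (mα := ⨆ t, M.F t) (motive := fun g =>
    ∫⁻ ω in C, g (M.shift t ω) ∂(M.P x) = ∫⁻ ω in C, ∫⁻ ω', g ω' ∂(M.P (M.X t ω)) ∂(M.P x))
    (fun c B hB => ?_) (fun f g _ hf hg ihf ihg => ?_) (fun f hf hmono ih => ?_) hg
  · have hB' := hle B hB
    have e : ∀ ω, B.indicator (fun _ => c) (M.shift t ω) =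
        (M.shift t ⁻¹' B).indicator (fun _ => c) ω := fun ω => rfl
    simp only [e]
    rw [lintegral_indicator_const (hshift hB), Measure.restrict_apply (hshift hB),
      Set.inter_comm, M.markov t x C B hC hB]
    simp only [lintegral_indicator_const hB']
    exact (lintegral_const_mul _ ((M.P.measurable_coe hB').comp (M.measurable_coord t))).symm
  · simp only [Pi.add_apply]
    rw [lintegral_add_left (hs hf), ihf, ihg, ← lintegral_add_left (hk hf)]
    exact lintegral_congr fun ω => (lintegral_add_left (hf.mono hle le_rfl) _).symm
  · simp only
    rw [lintegral_iSup (fun n => hs (hf n)) fun i j hij ω => hmono hij _]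
    simp only [ih]
    rw [← lintegral_iSup (fun n => hk (hf n))
      fun i j hij ω => lintegral_mono fun ω' => hmono hij ω']
    exact lintegral_congr fun ω =>
      (lintegral_iSup (fun n => (hf n).mono hle le_rfl) hmono).symm

/-- The measure `E_x (1_· 1_{τ_{A ∘ θ_s} > t} η_{s+t}(X_t))`. -/
noncomputable def weighted (M : MarkovFamily I E Ω) (A : I → Set E) (η : I → E → ℝ) (s t : I)
    (x : E) : Measure Ω :=
  ((M.P x).restrict (M.surv A s t)).withDensity fun ω => ENNReal.ofReal (η (s + t) (M.X t ω))

theorem weighted_apply {s t : I} {x : E} {C : Set Ω} (hC : MeasurableSet C) :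
    M.weighted A η s t x C =
      ∫⁻ ω in C ∩ M.surv A s t, ENNReal.ofReal (η (s + t) (M.X t ω)) ∂(M.P x) := by
  rw [weighted, withDensity_apply _ hC, Measure.restrict_restrict hC]

/-- Survival during the last `r` units and the weight at time `t + r` are functions of the shifted
trajectory, so the functional Markov property applies. -/
theorem weighted_add (hA : M.IsMovingBoundary A) (hη : ∀ s, Measurable (η s)) (s t r : I) (x : E)
    {C D : Set Ω} (hC : MeasurableSet[M.F t] C) (hD : MeasurableSet[M.F r] D) :
    M.weighted A η s (t + r) x (C ∩ M.shift t ⁻¹' D) =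
      ∫⁻ ω in C ∩ M.surv A s t, M.weighted A η (s + t) r (M.X t ω) D ∂(M.P x) := by
  have hS := hA.measurableSet_surv_filtration (s + t) r
  have hle : (M.F r : MeasurableSpace Ω) ≤ ⨆ t, M.F t :=
    le_iSup (fun t => (M.F t : MeasurableSpace Ω)) r
  have hpre : ∀ {B}, MeasurableSet[M.F r] B → MeasurableSet (M.shift t ⁻¹' B) := fun hB =>
    M.F.le _ _ (M.measurable_shift t r hB)
  have hg : Measurable[⨆ t, M.F t]
      ((D ∩ M.surv A (s + t) r).indicator fun ω => ENNReal.ofReal (η (s + t + r) (M.X r ω))) :=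
    Measurable.mono (ma := M.F r) (Measurable.indicator (m := M.F r)
      (ENNReal.measurable_ofReal.comp
      ((hη _).comp (M.measurable_X r))) (hD.inter hS)) hle le_rfl
  have h := M.setLIntegral_shift t x (hC.inter (hA.measurableSet_surv_filtration s t)) hg
  simp only [lintegral_indicator (M.F.le r _ (hD.inter hS))] at h
  rw [weighted_apply ((M.F.le t _ hC).inter (hpre hD)), surv_add]
  simp only [weighted_apply (M.F.le r _ hD)]
  rw [← h]
  have e : ∀ ω, (D ∩ M.surv A (s + t) r).indicator
      (fun ω => ENNReal.ofReal (η (s + t + r) (M.X r ω))) (M.shift t ω) =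
      (M.shift t ⁻¹' (D ∩ M.surv A (s + t) r)).indicator
        (fun ω => ENNReal.ofReal (η (s + (t + r)) (M.X (t + r) ω))) ω := fun ω => by
    by_cases hω : M.shift t ω ∈ D ∩ M.surv A (s + t) r
    · rw [Set.indicator_of_mem hω, Set.indicator_of_mem (by exact hω), M.X_shift, add_assoc]
    · rw [Set.indicator_of_notMem hω, Set.indicator_of_notMem (by exact hω)]
  simp only [e]
  rw [lintegral_indicator (hpre (hD.inter hS)), Measure.restrict_restrict (hpre (hD.inter hS)),
    Set.preimage_inter]
  congr 2
  ext ω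
  simp only [Set.mem_inter_iff]
  tauto

end Weighted

end MarkovFamily

/-! ### The `η`-transform: Markov property and consistency -/

namespace MarkovFamily

section QLaw

set_option linter.unusedSectionVars false

variable {I : Type} [AddCommMonoid I] [ConditionallyCompleteLinearOrderBot I]
  [IsOrderedCancelAddMonoid I] [CanonicallyOrderedAdd I] [Sub I] [OrderedSub I] [NoMaxOrder I]
  [(atTop : Filter I).IsCountablyGenerated]
  {E : Type*} [MeasurableSpace E] {Ω : Type*} [MeasurableSpace Ω]
  {M : MarkovFamily I E Ω} {A : I → Set E} {ν : I → Measure E} {t₀ : I} {c₁ c₂ : ℝ}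
  {η : I → E → ℝ}

namespace IsNormalizedLimit

theorem exists_weighted_univ_eq (hη : M.IsNormalizedLimit A ν η) (hA : M.IsMovingBoundary A)
    (hC : M.ChampagnatVillemonais A ν t₀ c₁ c₂) (s t : I) :
    ∃ l : ℝ≥0∞, l ≠ 0 ∧ l ≠ ∞ ∧
      ∀ x, M.weighted A η s t x Set.univ = l * ENNReal.ofReal (η s x) := by
  obtain ⟨l, hl, h⟩ := hη.exists_setIntegral_eq hA hC s t
  refine ⟨ENNReal.ofReal l, by simpa using hl, ENNReal.ofReal_ne_top, fun x => ?_⟩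
  rw [weighted_apply MeasurableSet.univ, Set.univ_inter, ← ENNReal.ofReal_mul hl.le, ← h x,
    ofReal_integral_eq_lintegral_ofReal _ (ae_of_all _ fun ω => hη.nonneg _ _)]
  refine integrable_of_abs_le ((hη.measurable hA _).comp (M.measurable_coord t)) (K := 1 / c₂)
    fun ω => ?_
  exact (abs_of_nonneg (hη.nonneg _ _)).trans_le (hη.le hA hC _ _)

theorem weighted_univ_ne_zero (hη : M.IsNormalizedLimit A ν η) (hA : M.IsMovingBoundary A)
    (hC : M.ChampagnatVillemonais A ν t₀ c₁ c₂) (s t : I) {x : E} (hx : x ∈ (A s)ᶜ) :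
    M.weighted A η s t x Set.univ ≠ 0 := by
  obtain ⟨l, hl, -, h⟩ := hη.exists_weighted_univ_eq hA hC s t
  rw [h]
  exact mul_ne_zero hl (by simpa using hη.pos hA hC s hx)

theorem weighted_univ_ne_top (hη : M.IsNormalizedLimit A ν η) (hA : M.IsMovingBoundary A)
    (hC : M.ChampagnatVillemonais A ν t₀ c₁ c₂) (s t : I) (x : E) :
    M.weighted A η s t x Set.univ ≠ ∞ := by
  obtain ⟨l, -, hl, h⟩ := hη.exists_weighted_univ_eq hA hC s t
  rw [h]
  exact ENNReal.mul_ne_top hl ENNReal.ofReal_ne_top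

/-- The transition kernel of the `Q`-process between times `s` and `s + t`. -/
theorem exists_kernel (hη : M.IsNormalizedLimit A ν η) (hA : M.IsMovingBoundary A)
    (hC : M.ChampagnatVillemonais A ν t₀ c₁ c₂) (s t : I) :
    ∃ K : Kernel E Ω, IsMarkovKernel K ∧ ∀ x C, MeasurableSet C →
      M.weighted A η s t x C = M.weighted A η s t x Set.univ * K x C := by
  classical
  obtain ⟨l, hl0, hl, h⟩ := hη.exists_weighted_univ_eq hA hC s t
  have hS := hA.measurableSet_surv s t
  let f : E → Ω → ℝ≥0∞ := fun x ω => (l * ENNReal.ofReal (η s x))⁻¹ *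
    (M.surv A s t).indicator (fun ω => ENNReal.ofReal (η (s + t) (M.X t ω))) ω
  have hind : Measurable ((M.surv A s t).indicator
      fun ω => ENNReal.ofReal (η (s + t) (M.X t ω))) :=
    ((hη.measurable hA _).comp (M.measurable_coord t)).ennreal_ofReal.indicator hS
  have hf : Measurable (Function.uncurry f) :=
    ((((hη.measurable hA s).comp measurable_fst).ennreal_ofReal.const_mul l).inv).mul
      (hind.comp measurable_snd)
  have hw : ∀ x C, MeasurableSet C → M.P.withDensity f x C =
      (l * ENNReal.ofReal (η s x))⁻¹ * M.weighted A η s t x C := fun x C hC => by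
    rw [Kernel.withDensity_apply' _ hf, weighted_apply hC, lintegral_const_mul _ hind,
      lintegral_indicator hS, Measure.restrict_restrict hS, Set.inter_comm]
  have hne : ∀ x ∉ A s, l * ENNReal.ofReal (η s x) ≠ 0 ∧ l * ENNReal.ofReal (η s x) ≠ ∞ :=
    fun x hx => by
      rw [← h]
      exact ⟨hη.weighted_univ_ne_zero hA hC s t hx, hη.weighted_univ_ne_top hA hC s t x⟩
  -- On `A s` the weighted measure vanishes, so any Markov kernel will do there; `M.P` is taken.
  refine ⟨Kernel.piecewise (hA.measurableSet s) M.P (M.P.withDensity f), ⟨fun x => ?_⟩,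
    fun x C hC' => ?_⟩
  · by_cases hx : x ∈ A s
    · rw [Kernel.piecewise_apply, if_pos hx]; infer_instance
    · rw [Kernel.piecewise_apply, if_neg hx]
      refine ⟨?_⟩
      rw [hw x _ MeasurableSet.univ, h]
      exact ENNReal.inv_mul_cancel (hne x hx).1 (hne x hx).2
  · by_cases hx : x ∈ A s
    · have h0 : M.weighted A η s t x Set.univ = 0 := by
        rw [h, hη.eq_zero hA s hx]; simp
      rw [h0, zero_mul]
      exact measure_mono_null (Set.subset_univ C) h0
    · rw [Kernel.piecewise_apply, if_neg hx, hw x C hC', h, ← mul_assoc,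
        ENNReal.mul_inv_cancel (hne x hx).1 (hne x hx).2, one_mul]

/-- The Markov property of the transformed process. -/
theorem exists_weighted_add_eq (hη : M.IsNormalizedLimit A ν η) (hA : M.IsMovingBoundary A)
    (hC : M.ChampagnatVillemonais A ν t₀ c₁ c₂) (s t r : I) (K : Kernel E Ω)
    (hK : ∀ x C, MeasurableSet C →
      M.weighted A η (s + t) r x C = M.weighted A η (s + t) r x Set.univ * K x C) :
    ∃ l : ℝ≥0∞, l ≠ 0 ∧ l ≠ ∞ ∧ ∀ x C D, MeasurableSet[M.F t] C → MeasurableSet[M.F r] D →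
      M.weighted A η s (t + r) x (C ∩ M.shift t ⁻¹' D) =
        l * ∫⁻ ω in C, K (M.X t ω) D ∂(M.weighted A η s t x) := by
  obtain ⟨l, hl0, hl, h⟩ := hη.exists_weighted_univ_eq hA hC (s + t) r
  refine ⟨l, hl0, hl, fun x C D hCm hD => ?_⟩
  have hC' := M.F.le _ _ hCm
  have hD' := M.F.le _ _ hD
  have hm : Measurable fun ω => ENNReal.ofReal (η (s + t) (M.X t ω)) :=
    ((hη.measurable hA _).comp (M.measurable_coord t)).ennreal_ofReal
  have hk : Measurable fun ω => K (M.X t ω) D := (K.measurable_coe hD').comp (M.measurable_coord t)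
  rw [weighted_add hA (hη.measurable hA) s t r x hCm hD, weighted,
    setLIntegral_withDensity_eq_setLIntegral_mul _ hm hk hC', Measure.restrict_restrict hC',
    ← lintegral_const_mul _ (hm.mul hk)]
  refine lintegral_congr fun ω => ?_
  -- The mass `l η_{s+t}(X_t)` of the remaining piece supplies exactly the density of the weighted
  -- measure at time `t`.
  rw [hK _ D hD', h, mul_assoc]
  rfl

/-- Consistency on `F t`: the factor `l` disappears after normalisation. -/
theorem exists_weighted_add_eq_weighted (hη : M.IsNormalizedLimit A ν η)
    (hA : M.IsMovingBoundary A) (hC : M.ChampagnatVillemonais A ν t₀ c₁ c₂) (s t r : I) :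
    ∃ l : ℝ≥0∞, l ≠ 0 ∧ l ≠ ∞ ∧ ∀ x C, MeasurableSet[M.F t] C →
      M.weighted A η s (t + r) x C = l * M.weighted A η s t x C := by
  obtain ⟨K, hK1, hK⟩ := hη.exists_kernel hA hC (s + t) r
  obtain ⟨l, hl0, hl, h⟩ := hη.exists_weighted_add_eq hA hC s t r K hK
  refine ⟨l, hl0, hl, fun x C hCm => ?_⟩
  have := h x C Set.univ hCm MeasurableSet.univ
  simpa using this

end IsNormalizedLimit

/-- The law
`E_x (1_· 1_{τ_{A ∘ θ_s} > t} η_{s+t}(X_t)) / E_x (1_{τ_{A ∘ θ_s} > t} η_{s+t}(X_t))`. -/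
noncomputable def transformed (M : MarkovFamily I E Ω) (A : I → Set E) (η : I → E → ℝ) (s t : I)
    (x : E) : Measure Ω :=
  (M.weighted A η s t x Set.univ)⁻¹ • M.weighted A η s t x

namespace IsNormalizedLimit

theorem isProbabilityMeasure_transformed (hη : M.IsNormalizedLimit A ν η)
    (hA : M.IsMovingBoundary A) (hC : M.ChampagnatVillemonais A ν t₀ c₁ c₂) (s t : I) {x : E}
    (hx : x ∈ (A s)ᶜ) : IsProbabilityMeasure (M.transformed A η s t x) :=
  ⟨ENNReal.inv_mul_cancel (hη.weighted_univ_ne_zero hA hC s t hx)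
    (hη.weighted_univ_ne_top hA hC s t x)⟩

theorem transformed_add (hη : M.IsNormalizedLimit A ν η)
    (hA : M.IsMovingBoundary A) (hC : M.ChampagnatVillemonais A ν t₀ c₁ c₂) (s t r : I)
    (K : Kernel E Ω) [IsMarkovKernel K]
    (hK : ∀ x C, MeasurableSet C →
      M.weighted A η (s + t) r x C = M.weighted A η (s + t) r x Set.univ * K x C)
    (x : E) {C D : Set Ω} (hCm : MeasurableSet[M.F t] C) (hD : MeasurableSet[M.F r] D) :
    M.transformed A η s (t + r) x (C ∩ M.shift t ⁻¹' D) =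
      ∫⁻ ω in C, K (M.X t ω) D ∂(M.transformed A η s t x) := by
  obtain ⟨l, hl0, hl, h⟩ := hη.exists_weighted_add_eq hA hC s t r K hK
  have h1 := h x Set.univ Set.univ MeasurableSet.univ MeasurableSet.univ
  simp only [Set.preimage_univ, Set.inter_univ, measure_univ, lintegral_const,
    Measure.restrict_univ, one_mul] at h1
  rw [transformed, transformed, Measure.smul_apply, h x C D hCm hD, h1, Measure.restrict_smul,
    lintegral_smul_measure, smul_eq_mul, smul_eq_mul,
    ENNReal.mul_inv (.inl hl0) (.inl hl), mul_mul_mul_comm,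
    ENNReal.inv_mul_cancel hl0 hl, one_mul]

theorem transformed_add_map_path (hη : M.IsNormalizedLimit A ν η)
    (hA : M.IsMovingBoundary A) (hC : M.ChampagnatVillemonais A ν t₀ c₁ c₂) (s t r : I) (x : E) :
    (M.transformed A η s (t + r) x).map (M.path t) =
      (M.transformed A η s t x).map (M.path t) := by
  obtain ⟨l, hl0, hl, h⟩ := hη.exists_weighted_add_eq_weighted hA hC s t r
  ext B hB
  rw [Measure.map_apply (M.measurable_path t) hB, Measure.map_apply (M.measurable_path t) hB,
    transformed, transformed, Measure.smul_apply, Measure.smul_apply,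
    h x _ (M.measurable_path_filtration t hB), h x _ MeasurableSet.univ, smul_eq_mul, smul_eq_mul,
    ENNReal.mul_inv (.inl hl0) (.inl hl), mul_mul_mul_comm, ENNReal.inv_mul_cancel hl0 hl, one_mul]

end IsNormalizedLimit

end QLaw

end MarkovFamily

/-! ### Construction of the trajectory law by gluing segments -/

namespace MarkovFamily

section Construction

set_option linter.unusedSectionVars false

variable {I : Type} [AddCommMonoid I] [ConditionallyCompleteLinearOrderBot I]
  [IsOrderedCancelAddMonoid I] [CanonicallyOrderedAdd I] [Sub I] [OrderedSub I] [NoMaxOrder I]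
  [(atTop : Filter I).IsCountablyGenerated] [Archimedean I]
  {E : Type*} [MeasurableSpace E] {Ω : Type*} [MeasurableSpace Ω]
  {M : MarkovFamily I E Ω} {A : I → Set E} {ν : I → Measure E} {t₀ : I} {c₁ c₂ : ℝ}
  {η : I → E → ℝ}

theorem exists_nsmul_le_le {t₀ : I} (ht₀ : 0 < t₀) (u : I) :
    ∃ n : ℕ, n • t₀ ≤ u ∧ u ≤ (n + 1) • t₀ := by
  classical
  have h := Archimedean.arch u ht₀
  rcases hN : Nat.find h with _ | n
  · refine ⟨0, by simp, ?_⟩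
    have h1 := Nat.find_spec h
    rw [hN, zero_nsmul] at h1
    exact h1.trans zero_le
  · refine ⟨n, (not_le.1 (Nat.find_min h (m := n) (by omega))).le, ?_⟩
    have h1 := Nat.find_spec h
    rwa [hN] at h1

/-- The successive segments, of length `t₀`, of the trajectory `X`; the zeroth one is constant. -/
def segment (M : MarkovFamily I E Ω) (t₀ : I) : ℕ → Ω → I → E
  | 0, ω, _ => M.X 0 ω
  | n + 1, ω, u => M.X (n • t₀ + min u t₀) ω

theorem measurable_segment_filtration (M : MarkovFamily I E Ω) (t₀ : I) (n : ℕ) :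
    Measurable[M.F (n • t₀)] (M.segment t₀ n) := by
  refine @measurable_pi_lambda _ _ _ (M.F _) _ _ fun u => ?_
  cases n with
  | zero => exact (M.measurable_X 0).mono (M.F.mono zero_le) le_rfl
  | succ n =>
    refine (M.measurable_X (n • t₀ + min u t₀)).mono (M.F.mono ?_) le_rfl
    rw [succ_nsmul]
    exact add_le_add_right (min_le_right _ _) _

/-- The state from which the next segment starts is the value of the current one at `t₀`; the
constant zeroth segment makes this true for `n = 0`. -/
theorem segment_apply_self (M : MarkovFamily I E Ω) (t₀ : I) (n : ℕ) (ω : Ω) :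
    M.segment t₀ n ω t₀ = M.X (n • t₀) ω := by
  cases n with
  | zero => simp [segment]
  | succ n => simp [segment, succ_nsmul]

namespace IsNormalizedLimit

theorem transformed_zero_map_segment (hη : M.IsNormalizedLimit A ν η) (hA : M.IsMovingBoundary A)
    (hC : M.ChampagnatVillemonais A ν t₀ c₁ c₂) (s : I) {x : E} (hx : x ∈ (A s)ᶜ) :
    (M.transformed A η s ((0 : ℕ) • t₀) x).map (M.segment t₀ 0) = Measure.dirac fun _ => x := by
  have hp := hη.isProbabilityMeasure_transformed hA hC s ((0 : ℕ) • t₀) hx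
  have hc : Measurable fun (y : E) (_ : I) => y := measurable_pi_lambda _ fun _ => measurable_id
  have hX := M.measurable_coord 0
  have hac : M.transformed A η s ((0 : ℕ) • t₀) x ≪ M.P x :=
    ((withDensity_absolutelyContinuous _ _).trans
      Measure.restrict_le_self.absolutelyContinuous).smul_left _
  have h : (M.transformed A η s ((0 : ℕ) • t₀) x).map (M.X 0) = Measure.dirac x := by
    ext B hB
    rw [Measure.map_apply hX hB, Measure.dirac_apply' _ hB]
    by_cases hxB : x ∈ B
    · rw [Set.indicator_of_mem hxB, Pi.one_apply]
      exact (mem_ae_iff_prob_eq_one (hX hB)).1 (hac.ae_le (M.ae_start_mem hB hxB))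
    · rw [Set.indicator_of_notMem hxB]
      exact measure_eq_zero_iff_ae_notMem.2 (hac.ae_le (M.ae_start_mem hB.compl hxB))
  have e : M.segment t₀ 0 = (fun (y : E) (_ : I) => y) ∘ M.X 0 := rfl
  rw [e, ← Measure.map_map hc hX, h, Measure.map_dirac' hc]

/-- The laws of the transformed process on finite time intervals extend to a law on trajectories. -/
theorem exists_segmentLaw_eq (hη : M.IsNormalizedLimit A ν η) (hA : M.IsMovingBoundary A)
    (hC : M.ChampagnatVillemonais A ν t₀ c₁ c₂) (s : I) {x : E} (hx : x ∈ (A s)ᶜ) :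
    ∃ Q : Measure (I → E), IsProbabilityMeasure Q ∧
      ∀ t, segmentLaw Q s t = (M.transformed A η s t x).map (M.path t) := by
  choose K hK1 hK using fun n : ℕ => hη.exists_kernel hA hC (s + n • t₀) t₀
  have hH := fun n : ℕ => hη.isProbabilityMeasure_transformed hA hC s (n • t₀) hx
  have hψ : Measurable[M.F t₀] (fun ω u => M.X (min u t₀) ω : Ω → I → E) :=
    @measurable_pi_lambda _ _ _ (M.F _) _ _ fun u =>
      (M.measurable_X _).mono (M.F.mono (min_le_right _ _)) le_rfl
  have hψ' := hψ.mono (M.F.le t₀) le_rfl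
  have hZ : ∀ n, Measurable (M.segment t₀ n) := fun n =>
    (M.measurable_segment_filtration t₀ n).mono (M.F.le _) le_rfl
  have hmK : ∀ n, IsMarkovKernel (((K n).map (fun ω u => M.X (min u t₀) ω : Ω → I → E)).comap
      (fun w : I → E => w t₀) (measurable_pi_apply t₀)) := fun n => by
    have := Kernel.IsMarkovKernel.map (K n) hψ'
    infer_instance
  obtain ⟨q, hq, hqm⟩ := exists_measure_map_frestrictLe_eq
    (fun n => ((K n).map (fun ω u => M.X (min u t₀) ω : Ω → I → E)).comap
      (fun w : I → E => w t₀) (measurable_pi_apply t₀))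
    (fun _ => x) (fun n => M.transformed A η s (n • t₀) x) (M.segment t₀) hZ
    (hη.transformed_zero_map_segment hA hC s hx) fun n B B' hB hB' => by
      have hCm : MeasurableSet[M.F (n • t₀)]
          ((fun ω (i : Finset.Iic n) => M.segment t₀ i ω) ⁻¹' B) := by
        refine @measurable_pi_lambda _ _ _ (M.F _) _ _ (fun i => ?_) _ hB
        exact (M.measurable_segment_filtration t₀ i).mono
          (M.F.mono (nsmul_le_nsmul_left zero_le (Finset.mem_Iic.1 i.2))) le_rfl
      have e : M.segment t₀ (n + 1) ⁻¹' B' =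
          M.shift (n • t₀) ⁻¹' ((fun ω u => M.X (min u t₀) ω : Ω → I → E) ⁻¹' B') := by
        ext ω
        simp only [Set.mem_preimage, M.X_shift]
        rfl
      rw [succ_nsmul, e, hη.transformed_add hA hC s (n • t₀) t₀ (K n) (hK n) x hCm (hψ hB')]
      refine lintegral_congr fun ω => ?_
      rw [Kernel.comap_apply, Kernel.map_apply' _ hψ' _ hB', segment_apply_self]
  choose idx hidx hidx' using exists_nsmul_le_le hC.t₀_pos
  -- Gluing: the elapsed time `v - s` falls in segment `idx (v - s) + 1`, the shift by one skipping
  -- the constant segment. Truncated subtraction sends times before `s` to the start.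
  have hΘ : Measurable fun (w : ℕ → I → E) (v : I) =>
      w (idx (v - s) + 1) (v - s - idx (v - s) • t₀) := by fun_prop
  refine ⟨q.map fun w v => w (idx (v - s) + 1) (v - s - idx (v - s) • t₀),
    Measure.isProbabilityMeasure_map hΘ.aemeasurable, fun t => ?_⟩
  obtain ⟨N, hN⟩ := Archimedean.arch t hC.t₀_pos
  have hlt : ∀ u : Set.Icc (0 : I) t, idx u + 1 ≤ N + 1 := fun u => by
    have := (hidx u).trans (u.2.2.trans hN)
    exact Nat.succ_le_succ ((nsmul_le_nsmul_iff_left hC.t₀_pos).1 this)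
  let G : (Finset.Iic (N + 1) → I → E) → Set.Icc (0 : I) t → E := fun p u =>
    p ⟨idx u + 1, Finset.mem_Iic.2 (hlt u)⟩ (u - idx u • t₀)
  have hG : Measurable G := by fun_prop
  have hr : Measurable fun (w : I → E) (u : Set.Icc (0 : I) t) => w (s + u) := by fun_prop
  have e1 : (fun (w : I → E) (u : Set.Icc (0 : I) t) => w (s + u)) ∘
      (fun (w : ℕ → I → E) (v : I) => w (idx (v - s) + 1) (v - s - idx (v - s) • t₀)) =
      G ∘ Preorder.frestrictLe (N + 1) := by
    ext w u
    simp [G, add_tsub_cancel_left]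
  have e2 : G ∘ (fun ω (i : Finset.Iic (N + 1)) => M.segment t₀ i ω) = M.path t := by
    ext ω u
    have h1 : (u : I) - idx u • t₀ ≤ t₀ := by
      rw [tsub_le_iff_left, ← succ_nsmul]
      exact hidx' u
    simp only [G, Function.comp_apply, segment, path, min_eq_left h1,
      add_tsub_cancel_of_le (hidx u)]
  -- The chain gives the law at horizon `(N + 1) • t₀ ≥ t`; consistency brings it back to `t`.
  obtain ⟨r, hr'⟩ := exists_add_of_le (hN.trans (nsmul_le_nsmul_left zero_le (Nat.le_succ N)))
  have hZ' : Measurable fun ω (i : Finset.Iic (N + 1)) => M.segment t₀ i ω :=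
    measurable_pi_lambda _ fun i => hZ i
  rw [segmentLaw, Measure.map_map hr hΘ, e1,
    ← Measure.map_map hG (Preorder.measurable_frestrictLe _), hqm, Measure.map_map hG hZ', e2,
    hr', hη.transformed_add_map_path hA hC]

end IsNormalizedLimit

end Construction

end MarkovFamily

/-! ### Identification of the `Q`-process and rates of convergence -/

theorem tvDist_le_of_forall {S : Type*} [MeasurableSpace S] {μ₁ μ₂ : Measure S} {δ : ℝ}
    (h : ∀ B, MeasurableSet B → |μ₁.real B - μ₂.real B| ≤ δ) : tvDist μ₁ μ₂ ≤ δ :=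
  have : Nonempty {B : Set S // MeasurableSet B} := ⟨⟨∅, .empty⟩⟩
  ciSup_le fun B => h B B.2

namespace MarkovFamily

section Main

set_option linter.unusedSectionVars false

variable {I : Type} [AddCommMonoid I] [ConditionallyCompleteLinearOrderBot I]
  [IsOrderedCancelAddMonoid I] [CanonicallyOrderedAdd I] [Sub I] [OrderedSub I] [NoMaxOrder I]
  [(atTop : Filter I).IsCountablyGenerated] [Archimedean I]
  {E : Type*} [MeasurableSpace E] {Ω : Type*} [MeasurableSpace Ω]
  {M : MarkovFamily I E Ω} {A : I → Set E} {ν : I → Measure E} {t₀ : I} {c₁ c₂ : ℝ}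
  {η : I → E → ℝ}

namespace IsNormalizedLimit

theorem integral_weighted (hη : M.IsNormalizedLimit A ν η) (hA : M.IsMovingBoundary A)
    (s t : I) (x : E) (g : Ω → ℝ) :
    ∫ ω, g ω ∂(M.weighted A η s t x) =
      ∫ ω in M.surv A s t, g ω * η (s + t) (M.X t ω) ∂(M.P x) := by
  have hm : Measurable fun ω => ENNReal.ofReal (η (s + t) (M.X t ω)) :=
    ((hη.measurable hA _).comp (M.measurable_coord t)).ennreal_ofReal
  rw [weighted, integral_withDensity_eq_integral_toReal_smul hm (by simp)]
  simp only [ENNReal.toReal_ofReal (hη.nonneg _ _), smul_eq_mul, mul_comm]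

theorem weighted_real (hη : M.IsNormalizedLimit A ν η) (hA : M.IsMovingBoundary A)
    (s t : I) (x : E) {C : Set Ω} (hC : MeasurableSet C) :
    (M.weighted A η s t x).real C =
      ∫ ω in C ∩ M.surv A s t, η (s + t) (M.X t ω) ∂(M.P x) := by
  have h := hη.integral_weighted hA s t x (C.indicator 1)
  rw [integral_indicator_one hC] at h
  rw [h, ← Measure.restrict_restrict hC, ← integral_indicator hC]
  refine integral_congr_ae (ae_of_all _ fun ω => ?_)
  by_cases hω : ω ∈ C <;> simp [hω]

/-- `Q` extends the laws of the transformed process on finite time intervals. -/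
theorem exists_isExtension (hη : M.IsNormalizedLimit A ν η) (hA : M.IsMovingBoundary A)
    (hC : M.ChampagnatVillemonais A ν t₀ c₁ c₂) :
    ∃ Q : I → E → Measure (I → E), ∀ s, ∀ x ∈ (A s)ᶜ, IsProbabilityMeasure (Q s x) ∧
      ∀ t, segmentLaw (Q s x) s t = (M.transformed A η s t x).map (M.path t) := by
  classical
  refine ⟨fun s x => if h : x ∈ (A s)ᶜ then (hη.exists_segmentLaw_eq hA hC s h).choose else 0,
    fun s x hx => ?_⟩
  simp only [hx, dite_true]
  exact (hη.exists_segmentLaw_eq hA hC s hx).choose_spec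

variable {Q : I → E → Measure (I → E)}

theorem isProfileTransform (hη : M.IsNormalizedLimit A ν η) (hA : M.IsMovingBoundary A)
    (hQ : ∀ s, ∀ x ∈ (A s)ᶜ, IsProbabilityMeasure (Q s x) ∧
      ∀ t, segmentLaw (Q s x) s t = (M.transformed A η s t x).map (M.path t)) :
    M.IsProfileTransform A η Q := by
  intro s t x hx B hB
  have hB' := M.measurable_path t hB
  rw [(hQ s x hx).2, map_measureReal_apply (M.measurable_path t) hB, transformed,
    measureReal_ennreal_smul_apply, ENNReal.toReal_inv, ← measureReal_def,
    hη.weighted_real hA s t x hB', hη.weighted_real hA s t x MeasurableSet.univ, Set.univ_inter,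
    inv_mul_eq_div]

theorem integral_segmentLaw (hη : M.IsNormalizedLimit A ν η) (hA : M.IsMovingBoundary A)
    (hQ : ∀ s, ∀ x ∈ (A s)ᶜ, IsProbabilityMeasure (Q s x) ∧
      ∀ t, segmentLaw (Q s x) s t = (M.transformed A η s t x).map (M.path t))
    (s t : I) {x : E} (hx : x ∈ (A s)ᶜ) {g : (Set.Icc (0 : I) t → E) → ℝ} (hg : Measurable g) :
    ∫ p, g p ∂(segmentLaw (Q s x) s t) =
      (∫ ω in M.surv A s t, g (M.path t ω) * η (s + t) (M.X t ω) ∂(M.P x)) /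
        ∫ ω in M.surv A s t, η (s + t) (M.X t ω) ∂(M.P x) := by
  rw [(hQ s x hx).2, integral_map (M.measurable_path t).aemeasurable hg.aestronglyMeasurable,
    transformed, integral_smul_measure, hη.integral_weighted hA, ENNReal.toReal_inv,
    ← measureReal_def, hη.weighted_real hA s t x MeasurableSet.univ, Set.univ_inter, smul_eq_mul,
    inv_mul_eq_div]

theorem isQProcessFamily (hη : M.IsNormalizedLimit A ν η) (hA : M.IsMovingBoundary A)
    (hC : M.ChampagnatVillemonais A ν t₀ c₁ c₂)
    (hQ : ∀ s, ∀ x ∈ (A s)ᶜ, IsProbabilityMeasure (Q s x) ∧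
      ∀ t, segmentLaw (Q s x) s t = (M.transformed A η s t x).map (M.path t)) :
    M.IsQProcessFamily A Q := by
  refine fun s x hx => ⟨(hQ s x hx).1, fun t f hf ⟨K, hK⟩ => ?_⟩
  rw [hη.integral_segmentLaw hA hQ s t hx hf]
  have h1 := hη.tendsto_setIntegral hA hC s t x hf hK
  have h2 := hη.tendsto_setIntegral hA hC s t x (g := fun _ => 1) measurable_const (K := 1)
    fun _ => abs_one.le
  simp only [one_mul] at h2
  have hne : ∫ ω in M.surv A s t, η (s + t) (M.X t ω) ∂(M.P x) ≠ 0 := by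
    rw [← Set.univ_inter (M.surv A s t), ← hη.weighted_real hA s t x MeasurableSet.univ]
    exact (ENNReal.toReal_pos (hη.weighted_univ_ne_zero hA hC s t hx)
      (hη.weighted_univ_ne_top hA hC s t x)).ne'
  refine (h1.div h2 hne).congr fun T => ?_
  rw [integral_condPathLaw M A s t _ x hf, Pi.div_apply,
    div_div_div_cancel_right₀ (hC.integral_survProb_pos hA (s + t) T).ne']
  simp [survProb]

end IsNormalizedLimit

variable {Q : I → E → Measure (I → E)}

/-- The conditional law of the path on `[0,t]`, given survival up to `t + T`, is exponentially
close in `T` to the law of the `Q`-process. -/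
theorem ChampagnatVillemonais.abs_integral_condPathLaw_sub_segmentLaw_le
    (hA : M.IsMovingBoundary A) (hC : M.ChampagnatVillemonais A ν t₀ c₁ c₂)
    (hQ : M.IsQProcessFamily A Q) (n : ℕ) (s t : I) {T : I} (hT : n • t₀ ≤ T) {x : E}
    (hx : x ∈ (A s)ᶜ) {g : (Set.Icc (0 : I) t → E) → ℝ} (hg : Measurable g)
    (hg0 : ∀ p, 0 ≤ g p) (hg1 : ∀ p, g p ≤ 1) :
    |∫ p, g p ∂(M.condPathLaw A s x t (t + T)) - ∫ p, g p ∂(segmentLaw (Q s x) s t)| ≤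
      (1 - c₁ * c₂) ^ n / (c₁ * c₂) := by
  have h := (hQ s x hx).2 t g hg ⟨1, fun p => abs_le.2 ⟨by linarith [hg0 p], hg1 p⟩⟩
  have ht : Tendsto (fun r => T + r) atTop atTop :=
    tendsto_atTop_mono (fun _ => le_add_self) tendsto_id
  exact le_of_tendsto' ((tendsto_const_nhds.sub (h.comp ht)).abs) fun r =>
    hC.abs_integral_condPathLaw_sub_le hA n s t hT r hx hg hg0 hg1

/-- Indicators give the uniform bound `(1 - c₁ c₂)^n / (c₁ c₂)`. The prefactor claimed here is
larger, since `f_{s,t} ≥ f_{s,t₀+t} ≥ c₁ c₂ f_{s,t₀} sup f_{s+t₀,t}` and `c₁ c₂ ≤ 1`. -/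
theorem ChampagnatVillemonais.tvDist_condPathLaw_segmentLaw_le (hA : M.IsMovingBoundary A)
    (hC : M.ChampagnatVillemonais A ν t₀ c₁ c₂)
    (hQ : M.IsQProcessFamily A Q) (n : ℕ) (s t : I) {T : I} (hT : n • t₀ ≤ T) {x : E}
    (hx : x ∈ (A s)ᶜ) :
    tvDist (M.condPathLaw A s x t (t + T)) (segmentLaw (Q s x) s t) ≤
      1 / ((c₁ * c₂) ^ 3 * (M.P x).real (M.surv A s t₀)) *
        ((M.P x).real (M.surv A s t) / M.supSurv A (s + t₀) t) * (1 - c₁ * c₂) ^ n := by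
  have hc := hC.mul_pos
  have hc1 := hC.mul_le_one hA
  have hpow : 0 ≤ (1 - c₁ * c₂) ^ n := pow_nonneg (by linarith) n
  have hf := hA.survProb_pos s t₀ hx
  have hΦ := hC.supSurv_pos hA (s + t₀) t
  refine (tvDist_le_of_forall (δ := (1 - c₁ * c₂) ^ n / (c₁ * c₂)) fun B hB => ?_).trans ?_
  · have h := hC.abs_integral_condPathLaw_sub_segmentLaw_le hA hQ n s t hT hx
      (g := B.indicator 1) (measurable_one.indicator hB)
      (Set.indicator_nonneg fun _ _ => zero_le_one)
      (Set.indicator_le_self' fun _ _ => zero_le_one)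
    rwa [integral_indicator_one hB, integral_indicator_one hB] at h
  · have h1 : c₁ * c₂ * M.supSurv A (s + t₀) t * M.survProb A s t₀ x ≤ M.survProb A s t x :=
      (hC.le_survProb_add hA s t x).trans (survProb_antitone s x le_add_self)
    change _ ≤ 1 / ((c₁ * c₂) ^ 3 * M.survProb A s t₀ x) *
      (M.survProb A s t x / M.supSurv A (s + t₀) t) * _
    rw [div_eq_inv_mul]
    refine mul_le_mul_of_nonneg_right ?_ hpow
    rw [div_mul_div_comm, one_mul, le_div_iff₀ (by positivity), inv_mul_le_iff₀ hc]
    have h2 := mul_le_mul_of_nonneg_left h1 hc.le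
    have h3 : 0 ≤ (c₁ * c₂) ^ 2 * (M.survProb A s t₀ x * M.supSurv A (s + t₀) t) := by positivity
    linarith [mul_le_mul_of_nonneg_left hc1 h3]

/-- The one-dimensional marginals of the conditioned process and of the `Q`-process are
exponentially close in the remaining time. -/
theorem ChampagnatVillemonais.abs_integral_cond_sub_le (hA : M.IsMovingBoundary A)
    (hC : M.ChampagnatVillemonais A ν t₀ c₁ c₂) (hQ : M.IsQProcessFamily A Q) (n : ℕ) {u t : I}
    (hu : u + n • t₀ ≤ t) {x : E} (hx : x ∈ (A 0)ᶜ) {f : E → ℝ} (hf : Measurable f) {K : ℝ}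
    (hK0 : 0 < K) (hK : ∀ y, |f y| ≤ K) :
    |∫ ω, f (M.X u ω) ∂((M.P x)[|M.surv A 0 t]) - ∫ w, f (w u) ∂(Q 0 x)| ≤
      2 * K * ((1 - c₁ * c₂) ^ n / (c₁ * c₂)) := by
  obtain ⟨T, hT⟩ := exists_add_of_le (le_self_add.trans hu)
  rw [hT] at hu ⊢
  have hu' : n • t₀ ≤ T := le_of_add_le_add_left hu
  have := (hQ 0 x hx).1
  have := hA.isProbabilityMeasure_condPathLaw 0 u (u + T) hx
  have hcond := cond_isProbabilityMeasure (hA.survive 0 (u + T) x hx).ne'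
  let i : Set.Icc (0 : I) u := ⟨u, zero_le, le_rfl⟩
  -- Rescaling to `[0,1]`; undoing it produces the factor `2 * K`.
  have hg : Measurable fun p : Set.Icc (0 : I) u → E => (f (p i) + K) / (2 * K) :=
    ((hf.comp (measurable_pi_apply i)).add_const K).div_const _
  have h := hC.abs_integral_condPathLaw_sub_segmentLaw_le hA hQ n 0 u hu' hx hg
    (fun p => div_nonneg (by linarith [(abs_le.1 (hK (p i))).1]) (by linarith))
    (fun p => (div_le_one (by linarith)).2 (by linarith [(abs_le.1 (hK (p i))).2]))
  have hr : Measurable fun (w : I → E) (v : Set.Icc (0 : I) u) => w (0 + v) := by fun_prop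
  rw [condPathLaw, segmentLaw, integral_map (M.measurable_path u).aemeasurable
    hg.aestronglyMeasurable, integral_map hr.aemeasurable hg.aestronglyMeasurable,
    integral_div, integral_div, integral_add, integral_add] at h
  · simp only [integral_const, probReal_univ, smul_eq_mul, one_mul, zero_add] at h
    rw [← sub_div, add_sub_add_right_eq_sub, abs_div, abs_of_pos (by linarith : 0 < 2 * K),
      div_le_iff₀' (by linarith)] at h
    exact h
  · exact integrable_of_abs_le (hf.comp (measurable_pi_apply _)) fun _ => hK _
  · exact integrable_const _
  · exact integrable_of_abs_le (hf.comp (M.measurable_coord _)) fun _ => hK _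
  · exact integrable_const _

theorem ChampagnatVillemonais.exists_abs_integral_cond_sub_le (hA : M.IsMovingBoundary A)
    (hC : M.ChampagnatVillemonais A ν t₀ c₁ c₂) (hQ : M.IsQProcessFamily A Q)
    {x : E} (hx : x ∈ (A 0)ᶜ) {f : E → ℝ} (hf : Measurable f) {K : ℝ}
    (hK0 : 0 < K) (hK : ∀ y, |f y| ≤ K) {ε : ℝ} (hε : 0 < ε) :
    ∃ L : I, ∀ u t, u + L ≤ t →
      |∫ ω, f (M.X u ω) ∂((M.P x)[|M.surv A 0 t]) - ∫ w, f (w u) ∂(Q 0 x)| ≤ ε := by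
  have h0 : Tendsto (fun n : ℕ => 2 * K * ((1 - c₁ * c₂) ^ n / (c₁ * c₂))) atTop (𝓝 0) := by
    simpa using ((hC.tendsto_pow hA).div_const (c₁ * c₂)).const_mul (2 * K)
  obtain ⟨n, hn⟩ := (h0.eventually_lt_const hε).exists
  exact ⟨n • t₀, fun u t hu => (hC.abs_integral_cond_sub_le hA hQ n hu hx hf hK0 hK).trans hn.le⟩

/-- Existence of the survival profile and of the `Q`-process, with exponential convergence. -/
theorem ChampagnatVillemonais.exists_qProcess (hA : M.IsMovingBoundary A)
    (hC : M.ChampagnatVillemonais A ν t₀ c₁ c₂) :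
    ∃ (η : I → E → ℝ) (Q : I → E → Measure (I → E)),
      M.IsSurvivalProfile A η ∧ M.IsProfileTransform A η Q ∧ M.IsQProcessFamily A Q := by
  obtain ⟨η, hη⟩ := hC.exists_isNormalizedLimit hA
  obtain ⟨Q, hQ⟩ := hη.exists_isExtension hA hC
  exact ⟨η, Q, hη.isSurvivalProfile hA hC, hη.isProfileTransform hA hQ,
    hη.isQProcessFamily hA hC hQ⟩

end Main

end MarkovFamily

/-! ### Time averages -/

namespace MarkovFamily

section Averages

variable {E : Type*} [MeasurableSpace E] {Ω : Type*} [MeasurableSpace Ω] {c₁ c₂ : ℝ}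

/-- In discrete time, the averages of the conditioned process and of the `Q`-process agree
asymptotically. -/
theorem ChampagnatVillemonais.tendsto_average_sub_nat {M : MarkovFamily ℕ E Ω} {A : ℕ → Set E}
    {ν : ℕ → Measure E} {t₀ : ℕ} (hA : M.IsMovingBoundary A)
    (hC : M.ChampagnatVillemonais A ν t₀ c₁ c₂) {Q : ℕ → E → Measure (ℕ → E)}
    (hQ : M.IsQProcessFamily A Q) {x : E} (hx : x ∈ (A 0)ᶜ) {f : E → ℝ} (hf : Measurable f)
    {K : ℝ} (hK0 : 0 < K) (hK : ∀ y, |f y| ≤ K) :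
    Tendsto (fun n : ℕ =>
      (1 / (n : ℝ)) * ∑ k ∈ Finset.range (n + 1), ∫ ω, f (M.X k ω) ∂((M.P x)[|M.surv A 0 n]) -
        (1 / (n : ℝ)) * ∑ k ∈ Finset.range (n + 1), ∫ w, f (w k) ∂(Q 0 x)) atTop (𝓝 0) := by
  set b : ℕ → ℝ := fun j => 2 * K * ((1 - c₁ * c₂) ^ (j / t₀) / (c₁ * c₂)) with hb
  have hdiv : Tendsto (fun j => j / t₀) atTop atTop :=
    tendsto_atTop.2 fun a => (eventually_ge_atTop (a * t₀)).mono fun j hj =>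
      (Nat.le_div_iff_mul_le hC.t₀_pos).2 hj
  have hb0 : Tendsto b atTop (𝓝 0) := by
    simpa using (((hC.tendsto_pow hA).comp hdiv).div_const (c₁ * c₂)).const_mul (2 * K)
  have hlim : Tendsto (fun n : ℕ => (1 / (n : ℝ)) * ∑ k ∈ Finset.range (n + 1), b k) atTop
      (𝓝 0) := by
    -- The Cesàro mean has `n` terms and the average here `n + 1`; the surplus is `b n / n`.
    have h1 := hb0.cesaro.add (tendsto_one_div_atTop_nhds_zero_nat.mul hb0)
    simp only [mul_zero, add_zero] at h1
    refine h1.congr fun n => ?_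
    rw [Finset.sum_range_succ, mul_add, one_div]
  refine squeeze_zero_norm (fun n => ?_) hlim
  -- The error at time `k` is governed by the remaining time `n - k`, hence the reflected sum.
  rw [← mul_sub, ← Finset.sum_sub_distrib, norm_mul, Real.norm_of_nonneg (by positivity),
    ← Finset.sum_range_reflect b]
  refine mul_le_mul_of_nonneg_left ((norm_sum_le _ _).trans (Finset.sum_le_sum fun k hk => ?_))
    (by positivity)
  have hk' : k ≤ n := Nat.lt_succ_iff.1 (Finset.mem_range.1 hk)
  refine hC.abs_integral_cond_sub_le hA hQ ((n + 1 - 1 - k) / t₀) ?_ hx hf hK0 hK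
  have := Nat.div_mul_le_self (n + 1 - 1 - k) t₀
  rw [smul_eq_mul]
  omega

/-- In continuous time, the averages of the conditioned process and of the `Q`-process agree
asymptotically. -/
theorem ChampagnatVillemonais.tendsto_average_sub_nnreal {M : MarkovFamily ℝ≥0 E Ω}
    {A : ℝ≥0 → Set E} {ν : ℝ≥0 → Measure E} {t₀ : ℝ≥0} (hA : M.IsMovingBoundary A)
    (hC : M.ChampagnatVillemonais A ν t₀ c₁ c₂) {Q : ℝ≥0 → E → Measure (ℝ≥0 → E)}
    (hQ : M.IsQProcessFamily A Q) (hX : Measurable fun p : ℝ≥0 × Ω => M.X p.1 p.2)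
    {x : E} (hx : x ∈ (A 0)ᶜ) {f : E → ℝ} (hf : Measurable f)
    {K : ℝ} (hK0 : 0 < K) (hK : ∀ y, |f y| ≤ K) :
    Tendsto (fun t : ℝ≥0 =>
      (1 / (t : ℝ)) *
          (∫ r in (0 : ℝ)..t, ∫ ω, f (M.X r.toNNReal ω) ∂((M.P x)[|M.surv A 0 t])) -
        (1 / (t : ℝ)) * ∫ r in (0 : ℝ)..t, ∫ w, f (w r.toNNReal) ∂(Q 0 x)) atTop (𝓝 0) := by
  have hQp := (hQ 0 x hx).1
  have hcond : ∀ t, IsProbabilityMeasure ((M.P x)[|M.surv A 0 t]) := fun t =>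
    cond_isProbabilityMeasure (hA.survive 0 t x hx).ne'
  set a : ℝ≥0 → ℝ → ℝ := fun t r => ∫ ω, f (M.X r.toNNReal ω) ∂((M.P x)[|M.surv A 0 t]) with ha
  set b : ℝ → ℝ := fun r => ∫ w, f (w r.toNNReal) ∂(Q 0 x) with hb
  have hK' : ∀ y, ‖f y‖ ≤ K := hK
  have hbK : ∀ r, ‖b r‖ ≤ K := fun r => by
    simpa using norm_integral_le_of_norm_le_const (μ := Q 0 x)
      (ae_of_all _ fun w => hK' (w r.toNNReal))
  have haK : ∀ t r, ‖a t r‖ ≤ K := fun t r => by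
    simpa using norm_integral_le_of_norm_le_const (μ := (M.P x)[|M.surv A 0 t])
      (ae_of_all _ fun ω => hK' (M.X r.toNNReal ω))
  have ham : ∀ t, Measurable (a t) := fun t => by
    have h : Measurable fun p : ℝ × Ω => f (M.X p.1.toNNReal p.2) :=
      hf.comp (hX.comp ((measurable_real_toNNReal.comp measurable_fst).prodMk measurable_snd))
    exact h.stronglyMeasurable.integral_prod_right.measurable
  have hdec : ∀ ε : ℝ, 0 < ε → ∃ L : ℝ≥0, ∀ u t, u + L ≤ t → |a t u - b u| ≤ ε := fun ε hε => by
    obtain ⟨L, hL⟩ := hC.exists_abs_integral_cond_sub_le hA hQ hx hf hK0 hK hε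
    exact ⟨L, fun u t h => by simpa [ha, hb] using hL u t h⟩
  -- The law `Q 0 x` lives on the product σ-algebra, where evaluation need not be jointly
  -- measurable; `b` is instead a pointwise limit of the measurable `a t`.
  have hbm : Measurable b := by
    refine measurable_of_tendsto_metrizable' atTop ham (tendsto_pi_nhds.2 fun r => ?_)
    refine Metric.tendsto_atTop.2 fun ε hε => ?_
    obtain ⟨L, hL⟩ := hdec (ε / 2) (half_pos hε)
    refine ⟨r.toNNReal + L, fun t ht => ?_⟩
    have h := hL r.toNNReal t ht
    have e1 : a t (r.toNNReal : ℝ) = a t r := by simp only [ha, Real.toNNReal_coe]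
    have e2 : b (r.toNNReal : ℝ) = b r := by simp only [hb, Real.toNNReal_coe]
    rw [e1, e2] at h
    exact (Real.dist_eq _ _).trans_lt (h.trans_lt (half_lt_self hε))
  refine Metric.tendsto_nhds.2 fun ε hε => ?_
  obtain ⟨L, hL⟩ := hdec (ε / 2) (half_pos hε)
  have hL0 : Tendsto (fun t : ℝ≥0 => 2 * K * L / (t : ℝ)) atTop (𝓝 0) :=
    tendsto_const_nhds.div_atTop (NNReal.tendsto_coe_atTop.2 tendsto_id)
  filter_upwards [hL0.eventually_lt_const (half_pos hε), eventually_gt_atTop 0] with t ht ht0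
  have ht0' : (0 : ℝ) < t := ht0
  have hai : IntervalIntegrable (a t) volume 0 t :=
    (intervalIntegrable_const (c := K)).mono_fun (ham t).aestronglyMeasurable
      (ae_of_all _ fun r => (haK t r).trans (le_abs_self K))
  have hbi : IntervalIntegrable b volume 0 t :=
    (intervalIntegrable_const (c := K)).mono_fun hbm.aestronglyMeasurable
      (ae_of_all _ fun r => (hbK r).trans (le_abs_self K))
  -- The integrand is at most `ε / 2` up to time `t - L` and at most `2 * K` on the last stretch of
  -- length `L`.
  have key : ‖∫ r in (0 : ℝ)..t, (a t r - b r)‖ ≤ ε / 2 * t + 2 * K * L := by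
    rw [intervalIntegral.integral_of_le ht0'.le]
    have hi1 : Integrable (fun _ : ℝ => ε / 2) (volume.restrict (Set.Ioc (0 : ℝ) t)) :=
      integrable_const _
    have hi2 : Integrable ((Set.Ioc ((t : ℝ) - L) t).indicator fun _ => 2 * K)
        (volume.restrict (Set.Ioc (0 : ℝ) t)) :=
      (integrable_const _).indicator measurableSet_Ioc
    refine (norm_integral_le_of_norm_le (hi1.add hi2)
      ((ae_restrict_iff' measurableSet_Ioc).2 (ae_of_all _ fun r hr => ?_))).trans ?_
    · by_cases h : r ≤ t - L
      · have h1 := hL r.toNNReal t (by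
          rw [← NNReal.coe_le_coe, NNReal.coe_add, Real.coe_toNNReal _ hr.1.le]
          linarith)
        rw [Real.coe_toNNReal _ hr.1.le] at h1
        exact h1.trans (le_add_of_nonneg_right (Set.indicator_nonneg (fun _ _ => by positivity) _))
      · have hm : r ∈ Set.Ioc ((t : ℝ) - L) t := ⟨not_le.1 h, hr.2⟩
        simp only [Pi.add_apply, Set.indicator_of_mem hm]
        linarith [norm_sub_le (a t r) (b r), haK t r, hbK r]
    · simp only [Pi.add_apply]
      rw [integral_add hi1 hi2, integral_indicator_const _ measurableSet_Ioc, integral_const,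
        smul_eq_mul, smul_eq_mul, measureReal_restrict_apply_univ,
        Real.volume_real_Ioc_of_le ht0'.le,
        measureReal_restrict_apply measurableSet_Ioc, sub_zero]
      have hv : volume.real (Set.Ioc ((t : ℝ) - L) t ∩ Set.Ioc (0 : ℝ) t) ≤ L := by
        refine (measureReal_mono Set.inter_subset_left (by simp)).trans ?_
        rw [Real.volume_real_Ioc_of_le (by linarith [L.coe_nonneg])]
        linarith
      have := mul_le_mul_of_nonneg_left hv (by positivity : 0 ≤ 2 * K)
      linarith
  rw [dist_zero_right, ← mul_sub, ← intervalIntegral.integral_sub hai hbi, norm_mul,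
    Real.norm_of_nonneg (by positivity), one_div, inv_mul_lt_iff₀ ht0']
  rw [div_lt_iff₀ ht0'] at ht
  linarith

end Averages

end MarkovFamily

/-! ### The theorem for both time sets -/

theorem mainTheorem1 :
    -- time set `ℕ`
    (∀ (E : Type*) [MeasurableSpace E] (Ω : Type*) [MeasurableSpace Ω]
      (M : MarkovFamily ℕ E Ω) (A : ℕ → Set E) (ν : ℕ → Measure E) (t₀ : ℕ) (c₁ c₂ : ℝ),
      M.IsMovingBoundary A → M.ChampagnatVillemonais A ν t₀ c₁ c₂ →
      ∃ (η : ℕ → E → ℝ) (Q : ℕ → E → Measure (ℕ → E)),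
        M.IsSurvivalProfile A η ∧ M.IsProfileTransform A η Q ∧ M.IsQProcessFamily A Q ∧
        (∀ s t T : ℕ, ∀ x ∈ (A s)ᶜ,
          tvDist (M.condPathLaw A s x t (t + T)) (segmentLaw (Q s x) s t) ≤
            1 / ((c₁ * c₂) ^ 3 * (M.P x).real (M.surv A s t₀)) *
              ((M.P x).real (M.surv A s t) / M.supSurv A (s + t₀) t) *
              (1 - c₁ * c₂) ^ ⌊(T : ℝ) / (t₀ : ℝ)⌋₊) ∧
        (M.RatioCondition A t₀ →
          ∀ [TopologicalSpace E] [OpensMeasurableSpace E] (β : Measure E) [IsProbabilityMeasure β],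
            (∀ x ∈ (A 0)ᶜ, ∀ f : E →ᵇ ℝ,
              Tendsto (fun n : ℕ => (1 / (n : ℝ)) *
                  ∑ k ∈ Finset.range (n + 1), ∫ w, f (w k) ∂(Q 0 x))
                atTop (𝓝 (∫ y, f y ∂β))) →
            ∀ x ∈ (A 0)ᶜ, ∀ f : E →ᵇ ℝ,
              Tendsto (fun n : ℕ => (1 / (n : ℝ)) *
                  ∑ k ∈ Finset.range (n + 1), ∫ ω, f (M.X k ω) ∂((M.P x)[|M.surv A 0 n]))
                atTop (𝓝 (∫ y, f y ∂β)))) ∧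
    -- time set `ℝ≥0`
    (∀ (E : Type*) [MeasurableSpace E] (Ω : Type*) [MeasurableSpace Ω]
      (M : MarkovFamily ℝ≥0 E Ω) (A : ℝ≥0 → Set E) (ν : ℝ≥0 → Measure E) (t₀ : ℝ≥0) (c₁ c₂ : ℝ),
      M.IsMovingBoundary A → M.ChampagnatVillemonais A ν t₀ c₁ c₂ →
      ∃ (η : ℝ≥0 → E → ℝ) (Q : ℝ≥0 → E → Measure (ℝ≥0 → E)),
        M.IsSurvivalProfile A η ∧ M.IsProfileTransform A η Q ∧ M.IsQProcessFamily A Q ∧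
        (∀ s t T : ℝ≥0, ∀ x ∈ (A s)ᶜ,
          tvDist (M.condPathLaw A s x t (t + T)) (segmentLaw (Q s x) s t) ≤
            1 / ((c₁ * c₂) ^ 3 * (M.P x).real (M.surv A s t₀)) *
              ((M.P x).real (M.surv A s t) / M.supSurv A (s + t₀) t) *
              (1 - c₁ * c₂) ^ ⌊(T : ℝ) / (t₀ : ℝ)⌋₊) ∧
        (M.RatioCondition A t₀ → Measurable (fun p : ℝ≥0 × Ω => M.X p.1 p.2) →
          ∀ [TopologicalSpace E] [OpensMeasurableSpace E] (β : Measure E) [IsProbabilityMeasure β],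
            (∀ x ∈ (A 0)ᶜ, ∀ f : E →ᵇ ℝ,
              Tendsto (fun t : ℝ≥0 => (1 / (t : ℝ)) *
                  ∫ r in (0 : ℝ)..t, ∫ w, f (w r.toNNReal) ∂(Q 0 x))
                atTop (𝓝 (∫ y, f y ∂β))) →
            ∀ x ∈ (A 0)ᶜ, ∀ f : E →ᵇ ℝ,
              Tendsto (fun t : ℝ≥0 => (1 / (t : ℝ)) *
                  ∫ r in (0 : ℝ)..t, ∫ ω, f (M.X r.toNNReal ω) ∂((M.P x)[|M.surv A 0 t]))
                atTop (𝓝 (∫ y, f y ∂β)))) := by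
  refine ⟨fun E _ Ω _ M A ν t₀ c₁ c₂ hA hC => ?_, fun E _ Ω _ M A ν t₀ c₁ c₂ hA hC => ?_⟩
  · obtain ⟨η, Q, hη, hηQ, hQ⟩ := hC.exists_qProcess hA
    refine ⟨η, Q, hη, hηQ, hQ, fun s t T x hx => ?_, fun _ _ _ β _ hβ x hx f => ?_⟩
    · refine hC.tvDist_condPathLaw_segmentLaw_le hA hQ _ s t ?_ hx
      have h0 : (0 : ℝ) < t₀ := Nat.cast_pos.2 hC.t₀_pos
      have h := Nat.floor_le (div_nonneg T.cast_nonneg h0.le)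
      rw [le_div_iff₀ h0] at h
      rw [smul_eq_mul]
      exact_mod_cast h
    -- The `+ 1` keeps the bound strictly positive when `f = 0`.
    · have h := hC.tendsto_average_sub_nat hA hQ hx f.continuous.measurable
        (K := ‖f‖ + 1) (by positivity) fun y => (f.norm_coe_le_norm y).trans (by linarith)
      simpa using h.add (hβ x hx f)
  · obtain ⟨η, Q, hη, hηQ, hQ⟩ := hC.exists_qProcess hA
    refine ⟨η, Q, hη, hηQ, hQ, fun s t T x hx => ?_, fun _ hX _ _ β _ hβ x hx f => ?_⟩
    · refine hC.tvDist_condPathLaw_segmentLaw_le hA hQ _ s t ?_ hx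
      have h0 : (0 : ℝ) < t₀ := hC.t₀_pos
      have h := Nat.floor_le (div_nonneg T.coe_nonneg h0.le)
      rw [le_div_iff₀ h0] at h
      rw [nsmul_eq_mul, ← NNReal.coe_le_coe]
      exact_mod_cast h
    · have h := hC.tendsto_average_sub_nnreal hA hQ hX hx f.continuous.measurable
        (K := ‖f‖ + 1) (by positivity) fun y => (f.norm_coe_le_norm y).trans (by linarith)
      simpa using h.add (hβ x hx f)
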